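/- Let $P$ be a probability measure on a measurable space $(\mathcal X,\mathcal A)$, let $n\ge 1$, and let $X_1,\dots,X_n$ be the coordinate projections of $(\mathcal X^n,\mathcal A^n,P^n)$. For measurable $f:\mathcal X\to\mathbb R$ write $Pf=\int f\,dP$, $\mathbb G_nf=n^{-1/2}\sum_{i=1}^n(f(X_i)-Pf)$, and for a class $\mathcal F$ of functions write $\|\mathbb G_n\|_{\mathcal F}=\sup_{f\in\mathcal F}|\mathbb G_nf|$ and $\mathcal F^k=\{f^k:f\in\mathcal F\}$. Let $\mathrm E_P^*$ denote outer expectation, i.e. the infimum of the expectations of the measurable majorants. An envelope function of $\mathcal F$ is a measurable $F:\mathcal X\to\mathbb R$ with $|f|\le F$ for all $f\in\mathcal F$. A class $\mathcal F$ is called $P$-measurable if for all $m$ and all $e_1,\dots,e_m\in\{-1,1\}$ the map $(x_1,\dots,x_m)\mapsto\sup_{f\in\mathcal F}|\sum_{i=1}^m e_if(x_i)|$ is measurable on the completion of $(\mathcal X^m,\mathcal A^m,P^m)$. For $\delta>0$ let $$J(\delta,\mathcal F,L_2)=\sup_Q\int_0^\delta\sqrt{1+\log N\bigl(\varepsilon\|F\|_{Q,2},\mathcal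 F,L_2(Q)\bigr)}\,d\varepsilon\in[0,\infty],$$ where the supremum is over all finitely discrete probability distributions $Q$ on $(\mathcal X,\mathcal A)$, $\|F\|_{Q,2}$ is the norm of $F$ in $L_2(Q)$, and $N(r,\mathcal F,L_2(Q))$ is the minimal number of closed balls of radius $r$ in $L_2(Q)$, with centres not necessarily in $\mathcal F$, needed to cover $\mathcal F$. **Theorem.** There is a function $c:\mathbb R^4\to[0,\infty)$ such that the following holds for all such $(\mathcal X,\mathcal A)$, $P$ and $n$. Let $\mathcal F$ be a $P$-measurable class of measurable functions with envelope function $F$ such that $P\exp(F^{p+\rho})<\infty$ for some $p,\rho>0$, and such that $\mathcal F^2$ and $\mathcal F^4$ are $P$-measurable. If $\delta\in(0,1/2)$ and $Pf^2<\delta^2PF^2$ for every $f\in\mathcal F$, then $$\mathrm E_P^*\|\mathbb G_n\|_{\mathcal F}\le c\,J(\delta,\mathcal F,L_2)\Bigl(1+\frac{J\bigl(\delta(\log(1/\delta))^{1/p},\mathcal F,L_2\bigr)}{\delta^2\sqrt n}\Bigr),\qquad c=c\bigl(p,PF^2,PF^4,P\exp(F^{p+\rho})\bigr).$$ -/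

import Mathlib

open MeasureTheory
open scoped ENNReal NNReal

namespace EmpiricalEntropy

/-- The outer expectation `E* T` of a `[0,∞]`-valued map `T` that need not be measurable: the
infimum of the expectations of its measurable majorants. -/
noncomputable def outerExpectation {Ω : Type*} [MeasurableSpace Ω] (μ : Measure Ω)
    (T : Ω → ℝ≥0∞) : ℝ≥0∞ :=
  ⨅ (U : Ω → ℝ≥0∞) (_ : Measurable U) (_ : ∀ ω, T ω ≤ U ω), ∫⁻ ω, U ω ∂μ

/-- The empirical process `𝔾ₙ f = n^{-1/2} ∑ᵢ (f(xᵢ) - P f)` of the sample `x₁, …, xₙ`. -/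
noncomputable def empProc {X : Type*} [MeasurableSpace X] (P : Measure X) {n : ℕ}
    (x : Fin n → X) (f : X → ℝ) : ℝ :=
  1 / √(n : ℝ) * ∑ i, (f (x i) - ∫ y, f y ∂P)

/-- The supremum `‖𝔾ₙ‖_ℱ = sup_{f ∈ ℱ} |𝔾ₙ f|`, as an element of `[0,∞]`. -/
noncomputable def empiricalSup {X : Type*} [MeasurableSpace X] (P : Measure X)
    (ℱ : Set (X → ℝ)) {n : ℕ} (x : Fin n → X) : ℝ≥0∞ :=
  ⨆ f ∈ ℱ, ENNReal.ofReal |empProc P x f|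

/-- A class of functions is `P`-measurable if, for all `n` and all signs `e₁, …, eₙ`, the map
`(x₁, …, xₙ) ↦ sup_{f ∈ ℱ} |∑ᵢ eᵢ f(xᵢ)|` is measurable on the completion of `(Xⁿ, Pⁿ)`. -/
def IsPMeasurable {X : Type*} [MeasurableSpace X] (P : Measure X) (ℱ : Set (X → ℝ)) : Prop :=
  ∀ (n : ℕ) (e : Fin n → ℝ), (∀ i, e i = 1 ∨ e i = -1) →
    NullMeasurable (fun x : Fin n → X => ⨆ f ∈ ℱ, ENNReal.ofReal |∑ i, e i * f (x i)|)
      (Measure.pi fun _ : Fin n => P)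

/-- The class `ℱᵏ = {fᵏ : f ∈ ℱ}` of pointwise powers. -/
def powClass {X : Type*} (ℱ : Set (X → ℝ)) (k : ℕ) : Set (X → ℝ) :=
  {g | ∃ f ∈ ℱ, g = fun x => f x ^ k}

/-- `F` is an envelope function of `ℱ`. -/
structure IsEnvelope {X : Type*} [MeasurableSpace X] (ℱ : Set (X → ℝ)) (F : X → ℝ) : Prop where
  measurable : Measurable F
  abs_le : ∀ f ∈ ℱ, ∀ x, |f x| ≤ F x

/-- `Q` is a finitely discrete probability distribution: a finite mixture of point masses. -/
def IsFinitelyDiscrete {X : Type*} [MeasurableSpace X] (Q : Measure X) : Prop :=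
  IsProbabilityMeasure Q ∧
    ∃ (s : Finset X) (w : X → ℝ≥0∞), Q = ∑ x ∈ s, w x • Measure.dirac x

/-- The covering number `N(r, ℱ, L₂(Q))`: the minimal number of balls of radius `r` in `L₂(Q)`
(centres not necessarily in `ℱ`) needed to cover `ℱ`. -/
noncomputable def coveringNumberL2 {X : Type*} [MeasurableSpace X] (Q : Measure X)
    (ℱ : Set (X → ℝ)) (r : ℝ≥0) : ℕ∞ :=
  Metric.externalCoveringNumber r {g : Lp ℝ 2 Q | ∃ f ∈ ℱ, (g : X → ℝ) =ᵐ[Q] f}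

/-- `√(1 + log N)`, with value `∞` at `N = ∞`. -/
noncomputable def sqrtOneAddLog (N : ℕ∞) : ℝ≥0∞ :=
  if N = ⊤ then ⊤ else ENNReal.ofReal √(1 + Real.log (N.toNat : ℝ))

/-- The uniform entropy integral
`J(δ, ℱ | F, L₂) = sup_Q ∫₀^δ √(1 + log N(ε ‖F‖_{Q,2}, ℱ, L₂(Q))) dε`, the supremum being over
all finitely discrete probability distributions `Q`. -/
noncomputable def uniformEntropyIntegral {X : Type*} [MeasurableSpace X] (ℱ : Set (X → ℝ))
    (F : X → ℝ) (δ : ℝ) : ℝ≥0∞ :=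
  ⨆ (Q : Measure X) (_ : IsFinitelyDiscrete Q), ∫⁻ ε in Set.Ioo 0 δ,
    sqrtOneAddLog (coveringNumberL2 Q ℱ (ENNReal.ofReal ε * eLpNorm F 2 Q).toNNReal)

end EmpiricalEntropy

/-! Symmetrization with a ghost sample replaces the centred process by Rademacher sums. For a fixed
sample these are controlled by Dudley chaining up to the random radius D, with D² ≥ ∑ᵢ f(xᵢ)² for
all f. The normalized entropy integrand is antitone, so its integral over (0, a) is at most (1 +
a/b) times its integral over (0, b). The random radius thus enters linearly, and with V = sup_f ∑ᵢ
f(Xᵢ)² and b = δ Jensen gives the bound 36 J(δ) (√(PF²) + √(EV/n)/δ)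
(`outerExpectation_empiricalSup_le`).

It remains to see that w = √(EV/n)/δ is of order 1 + B, where B = J(δL)/(δ²√n) and L =
log(1/δ)^(1/p). The same machinery is applied to the squares. Since |f² - g²| ≤ 2F|f - g| for g
clamped to [-F, F], their entropy is that of ℱ under the discrete law reweighted by F², and their
radius is governed by ∑ f⁴ ≤ K² ∑ f² + ∑ F⁴ 1{F > K}. Hence EV is bounded by an expression in √EV
(`integral_sqSup_le`). The choice K = (4 log(1/δ))^(1/p) makes the exponential tail of order δ², and
b = δL balances K. Dividing by nδ² leaves w² ≤ α + βB + γBw, which forces w ≲ 1 + B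
(`sqrt_integral_sqSup_le`). -/

namespace EmpiricalEntropy

/-! ### Rademacher sums and the finite maximal inequality. -/

section Rademacher

variable {ι : Type*} [Fintype ι]

/-- The real sign `±1` encoded by a Boolean. -/
def boolSign (b : Bool) : ℝ := cond b 1 (-1)

theorem boolSign_eq (b : Bool) : boolSign b = 1 ∨ boolSign b = -1 := by
  cases b <;> simp [boolSign]

theorem boolSign_sq (b : Bool) : boolSign b ^ 2 = 1 := by
  cases b <;> simp [boolSign]

/-- The signed sum `∑ᵢ eᵢ tᵢ`. -/
def radSum (e : ι → Bool) (t : EuclideanSpace ℝ ι) : ℝ := ∑ i, boolSign (e i) * t i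

theorem radSum_sub (e : ι → Bool) (s t : EuclideanSpace ℝ ι) :
    radSum e (s - t) = radSum e s - radSum e t := by
  simp [radSum, mul_sub, Finset.sum_sub_distrib]

theorem radSum_smul (e : ι → Bool) (c : ℝ) (t : EuclideanSpace ℝ ι) :
    radSum e (c • t) = c * radSum e t := by
  simp only [radSum, Finset.mul_sum, PiLp.smul_apply, smul_eq_mul]
  exact Finset.sum_congr rfl fun i _ => by ring

theorem abs_radSum_le (e : ι → Bool) (t : EuclideanSpace ℝ ι) :
    |radSum e t| ≤ √(Fintype.card ι) * ‖t‖ := by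
  rw [EuclideanSpace.norm_eq, ← Real.sqrt_mul (by positivity)]
  apply Real.abs_le_sqrt
  have h := Finset.sum_mul_sq_le_sq_mul_sq Finset.univ (fun i => boolSign (e i)) (fun i => t i)
  simpa [boolSign_sq, radSum] using h

/-- The sum over all signs factorizes into ∏ 2 cosh(tᵢ), and cosh u ≤ exp(u²/2). Expectations over
signs are kept as unnormalized sums, hence the powers of 2. -/
theorem sum_exp_radSum_le [DecidableEq ι] (t : EuclideanSpace ℝ ι) :
    ∑ e : ι → Bool, Real.exp (radSum e t) ≤ 2 ^ Fintype.card ι * Real.exp (‖t‖ ^ 2 / 2) := by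
  have h1 : ∑ e : ι → Bool, Real.exp (radSum e t) = ∏ i, (2 * Real.cosh (t i)) := by
    have := Finset.prod_univ_sum (fun _ : ι => (Finset.univ : Finset Bool))
      (fun i b => Real.exp (boolSign b * t i))
    rw [Fintype.piFinset_univ] at this
    simp only [radSum, Real.exp_sum]
    rw [← this]
    refine Finset.prod_congr rfl fun i _ => ?_
    simp [boolSign, Real.cosh_eq]
    ring
  rw [h1, EuclideanSpace.norm_sq_eq, Finset.sum_div, Real.exp_sum, ← Finset.card_univ,
    ← Finset.prod_const, ← Finset.prod_mul_distrib]
  refine Finset.prod_le_prod (fun i _ => by positivity) fun i _ => ?_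
  simpa using Real.cosh_le_exp_half_sq (t i)

/-- The maximal inequality for finitely many Rademacher sums. -/
theorem exists_radSum_majorant [DecidableEq ι] (A : Finset (EuclideanSpace ℝ ι)) {R : ℝ}
    (hR : 0 < R) (hA : ∀ a ∈ A, ‖a‖ ≤ R) :
    ∃ m : (ι → Bool) → ℝ, (∀ e, 0 ≤ m e) ∧ (∀ e, ∀ a ∈ A, |radSum e a| ≤ m e) ∧
      ∑ e, m e ≤ 2 ^ Fintype.card ι * (3 / 2 * R * √(1 + Real.log A.card)) := by
  rcases A.eq_empty_or_nonempty with rfl | hne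
  · exact ⟨fun _ => 0, fun _ => le_rfl, by simp, by simp; positivity⟩
  choose a haA ha using fun e : ι → Bool => A.exists_max_image (fun a => |radSum e a|) hne
  refine ⟨fun e => |radSum e (a e)|, fun e => abs_nonneg _, ha, ?_⟩
  have hM : (0 : ℝ) < A.card := by exact_mod_cast hne.card_pos
  have hlog : 0 ≤ Real.log A.card := Real.log_natCast_nonneg _
  set L := 1 + Real.log A.card with hL
  have hL0 : 0 < L := by linarith
  have hs : 0 < √L := Real.sqrt_pos.2 hL0
  have hsq : √L ^ 2 = L := Real.sq_sqrt hL0.le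
  -- With lR = √L every exponential moment is at most exp(L/2). Then c bounds the mean of exp(l ·
  -- max), the factor 2 accounting for the absolute value, and log c ≤ 3L/2 because log 2 < 1.
  set l := √L / R with hl
  have hl0 : 0 < l := by positivity
  have hlR : l * R = √L := by rw [hl]; field_simp
  set c := 2 * A.card * Real.exp (L / 2) with hc
  have hc0 : 0 < c := by positivity
  have hlogc : Real.log c ≤ 3 / 2 * L := by
    rw [hc, Real.log_mul (by positivity) (by positivity), Real.log_mul (by norm_num) hM.ne',
      Real.log_exp]
    have := Real.log_two_lt_d9
    linarith
  -- The tangent line of the logarithm at c, used in place of Jensen's inequality.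
  have hpt : ∀ e, l * |radSum e (a e)| ≤ Real.log c - 1 +
      Real.exp (l * |radSum e (a e)|) / c := by
    intro e
    have := Real.add_one_le_exp (l * |radSum e (a e)| - Real.log c)
    rw [Real.exp_sub, Real.exp_log hc0] at this
    linarith
  have hexp : ∑ e : ι → Bool, Real.exp (l * |radSum e (a e)|) ≤ 2 ^ Fintype.card ι * c := by
    have h1 : ∀ e : ι → Bool, Real.exp (l * |radSum e (a e)|) ≤
        ∑ b ∈ A, (Real.exp (radSum e (l • b)) + Real.exp (radSum e ((-l) • b))) := by
      intro e
      refine le_trans ?_ (Finset.single_le_sum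
        (f := fun b => Real.exp (radSum e (l • b)) + Real.exp (radSum e ((-l) • b)))
        (fun b _ => by positivity) (haA e))
      simp only [radSum_smul]
      rcases abs_cases (radSum e (a e)) with ⟨h, _⟩ | ⟨h, _⟩ <;> rw [h]
      · linarith [Real.exp_pos (-l * radSum e (a e))]
      · rw [mul_neg, ← neg_mul]
        linarith [Real.exp_pos (l * radSum e (a e))]
    have h2 : ∀ b ∈ A, ∀ s : ℝ, s ^ 2 = l ^ 2 → ∑ e : ι → Bool, Real.exp (radSum e (s • b)) ≤
        2 ^ Fintype.card ι * Real.exp (L / 2) := by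
      intro b hb s hs2
      refine (sum_exp_radSum_le _).trans ?_
      gcongr
      rw [norm_smul, mul_pow, Real.norm_eq_abs, sq_abs, hs2, ← hsq, ← hlR, mul_pow]
      gcongr
      exact hA b hb
    calc _ ≤ ∑ e : ι → Bool, ∑ b ∈ A, (Real.exp (radSum e (l • b)) +
          Real.exp (radSum e ((-l) • b))) := Finset.sum_le_sum fun e _ => h1 e
      _ = ∑ b ∈ A, (∑ e : ι → Bool, Real.exp (radSum e (l • b)) +
          ∑ e : ι → Bool, Real.exp (radSum e ((-l) • b))) := by
        rw [Finset.sum_comm]; simp only [Finset.sum_add_distrib]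
      _ ≤ ∑ b ∈ A, (2 ^ Fintype.card ι * Real.exp (L / 2) +
          2 ^ Fintype.card ι * Real.exp (L / 2)) :=
        Finset.sum_le_sum fun b hb => add_le_add (h2 b hb l rfl) (h2 b hb (-l) (by ring))
      _ = _ := by rw [Finset.sum_const, nsmul_eq_mul, hc]; ring
  have hsum : l * ∑ e : ι → Bool, |radSum e (a e)| ≤ 2 ^ Fintype.card ι * (3 / 2 * L) := by
    rw [Finset.mul_sum]
    refine (Finset.sum_le_sum fun e _ => hpt e).trans ?_
    rw [Finset.sum_add_distrib, ← Finset.sum_div, Finset.sum_const, nsmul_eq_mul]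
    have hcard : ((Finset.univ : Finset (ι → Bool)).card : ℝ) = 2 ^ Fintype.card ι := by
      simp
    rw [hcard]
    have : (∑ e : ι → Bool, Real.exp (l * |radSum e (a e)|)) / c ≤ 2 ^ Fintype.card ι := by
      rw [div_le_iff₀ hc0]; exact hexp
    have h2 : (2 : ℝ) ^ Fintype.card ι * Real.log c ≤ 2 ^ Fintype.card ι * (3 / 2 * L) := by
      gcongr
    linarith
  have key : 2 ^ Fintype.card ι * (3 / 2 * L) =
      l * (2 ^ Fintype.card ι * (3 / 2 * R * √L)) := by
    nth_rw 1 [← hsq]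
    rw [sq]
    nth_rw 1 [← hlR]
    ring
  rw [key] at hsum
  exact le_of_mul_le_mul_left hsum hl0

end Rademacher

/-! ### Dudley chaining along dyadic nets. -/

section Chaining

variable {ι : Type*} [Fintype ι]

theorem lintegral_Ioo_half_add_le {ψ : ℝ → ℝ≥0∞} (hψ : Antitone ψ) {r : ℝ} (hr : 0 < r) :
    (∫⁻ ε in Set.Ioo 0 (r / 2), ψ ε) + ENNReal.ofReal (r / 2) * ψ r ≤
      ∫⁻ ε in Set.Ioo 0 r, ψ ε := by
  have hsub : Set.Ioo 0 (r / 2) ∪ Set.Ioo (r / 2) r ⊆ Set.Ioo 0 r := by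
    rintro x (⟨h1, h2⟩ | ⟨h1, h2⟩)
    · exact ⟨h1, h2.trans (half_lt_self hr)⟩
    · exact ⟨(half_pos hr).trans h1, h2⟩
  refine le_trans ?_ (lintegral_mono_set hsub)
  rw [lintegral_union measurableSet_Ioo]
  · gcongr
    calc ENNReal.ofReal (r / 2) * ψ r = ∫⁻ _ in Set.Ioo (r / 2) r, ψ r := by
          rw [setLIntegral_const, Real.volume_Ioo, mul_comm]; congr 2; ring
      _ ≤ _ := setLIntegral_mono' measurableSet_Ioo fun x hx => hψ hx.2.le
  · rw [Set.disjoint_left]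
    rintro x ⟨_, h⟩ ⟨h', _⟩
    linarith

theorem sum_dyadic_le_lintegral {ψ : ℝ → ℝ≥0∞} (hψ : Antitone ψ) {a : ℝ} (ha : 0 < a) (K : ℕ) :
    ∑ k ∈ Finset.range K, ENNReal.ofReal (a / 2 ^ (k + 1)) * ψ (a / 2 ^ k) ≤
      ∫⁻ ε in Set.Ioo 0 a, ψ ε := by
  -- Keeping the integral over the part not yet used makes the induction close.
  suffices h : ∑ k ∈ Finset.range K, ENNReal.ofReal (a / 2 ^ (k + 1)) * ψ (a / 2 ^ k) +
      ∫⁻ ε in Set.Ioo 0 (a / 2 ^ K), ψ ε ≤ ∫⁻ ε in Set.Ioo 0 a, ψ ε from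
    le_self_add.trans h
  induction K with
  | zero => simp
  | succ K ih =>
    refine le_trans ?_ ih
    rw [Finset.sum_range_succ, add_assoc]
    gcongr
    have := lintegral_Ioo_half_add_le hψ (r := a / 2 ^ K) (by positivity)
    rw [add_comm]
    simpa [pow_succ, div_div] using this

theorem sqrt_one_add_log_card_le {E : Type*} [DecidableEq E] {A B D : Finset E}
    (h : D.card ≤ A.card * B.card) :
    √(1 + Real.log D.card) ≤ √(1 + Real.log A.card) + √(1 + Real.log B.card) := by
  have hA := Real.log_natCast_nonneg A.card
  have hB := Real.log_natCast_nonneg B.card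
  have hlog : Real.log D.card ≤ Real.log A.card + Real.log B.card := by
    rcases Nat.eq_zero_or_pos D.card with h0 | h0
    · rw [h0]; simp; positivity
    · have h1 : 0 < A.card * B.card := h0.trans_le h
      have hA0 : (A.card : ℝ) ≠ 0 := by
        exact_mod_cast (Nat.pos_of_mul_pos_right h1).ne'
      have hB0 : (B.card : ℝ) ≠ 0 := by
        exact_mod_cast (Nat.pos_of_mul_pos_left h1).ne'
      rw [← Real.log_mul hA0 hB0]
      exact Real.log_le_log (by exact_mod_cast h0) (by exact_mod_cast h)
  rw [Real.sqrt_le_left (by positivity), add_sq, Real.sq_sqrt (by positivity),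
    Real.sq_sqrt (by positivity)]
  have : 0 ≤ 2 * √(1 + Real.log A.card) * √(1 + Real.log B.card) := by positivity
  linarith

/-- One link of the chain: the increments between two nets. -/
theorem exists_link_majorant [DecidableEq ι] (A B : Finset (EuclideanSpace ℝ ι)) {R : ℝ}
    (hR : 0 < R) :
    ∃ m : (ι → Bool) → ℝ, (∀ e, 0 ≤ m e) ∧
      (∀ e, ∀ a ∈ A, ∀ b ∈ B, ‖b - a‖ ≤ R → |radSum e b - radSum e a| ≤ m e) ∧
      ∑ e, m e ≤ 2 ^ Fintype.card ι *
        (3 / 2 * R * (√(1 + Real.log A.card) + √(1 + Real.log B.card))) := by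
  classical
  set D := ((A ×ˢ B).image fun q => q.2 - q.1).filter fun v => ‖v‖ ≤ R
  obtain ⟨m, h0, h1, h2⟩ := exists_radSum_majorant D hR fun a ha => (Finset.mem_filter.1 ha).2
  refine ⟨m, h0, fun e a ha b hb hab => ?_, h2.trans ?_⟩
  · rw [← radSum_sub]
    refine h1 e _ (Finset.mem_filter.2 ⟨Finset.mem_image.2 ⟨(a, b), ?_, rfl⟩, hab⟩)
    exact Finset.mem_product.2 ⟨ha, hb⟩
  · gcongr
    refine sqrt_one_add_log_card_le ?_
    rw [← Finset.card_product]
    exact (Finset.card_filter_le _ _).trans Finset.card_image_le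

/-- The chain starts at 0, and consecutive net points differ by at most r k + r (k+1) = 3 r (k+1).
The majorants do not depend on t, so they survive the supremum. The last remainder is bounded
crudely by Cauchy–Schwarz and disappears as K → ∞. -/
theorem exists_chain_majorant [DecidableEq ι] {T : Set (EuclideanSpace ℝ ι)} {r : ℕ → ℝ}
    (hr0 : ∀ k, 0 < r k) (hr : ∀ k, r k = 2 * r (k + 1)) (C : ℕ → Finset (EuclideanSpace ℝ ι))
    (hC0 : C 0 = {0}) (hC : ∀ k, ∀ t ∈ T, ∃ c ∈ C k, ‖t - c‖ ≤ r k) :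
    ∃ m : ℕ → (ι → Bool) → ℝ, (∀ k e, 0 ≤ m k e) ∧
      (∀ K e, ∀ t ∈ T, |radSum e t| ≤
        ∑ k ∈ Finset.range K, m k e + √(Fintype.card ι) * r K) ∧
      ∀ k, ∑ e, m k e ≤ 2 ^ Fintype.card ι * (3 / 2 * (3 * r (k + 1)) *
        (√(1 + Real.log (C k).card) + √(1 + Real.log (C (k + 1)).card))) := by
  choose m h0 h1 h2 using fun k => exists_link_majorant (C k) (C (k + 1))
    (R := 3 * r (k + 1)) (by have := hr0 (k + 1); positivity)
  refine ⟨m, h0, fun K e t ht => ?_, h2⟩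
  choose c hc hct using fun k => hC k t ht
  have hchain : ∀ K, |radSum e (c K)| ≤ ∑ k ∈ Finset.range K, m k e := by
    intro K
    induction K with
    | zero =>
      have : c 0 = 0 := by simpa [hC0] using hc 0
      simp [this, radSum]
    | succ K ih =>
      rw [Finset.sum_range_succ]
      have hd : ‖c (K + 1) - c K‖ ≤ 3 * r (K + 1) := by
        have h3 : c (K + 1) - c K = (t - c K) - (t - c (K + 1)) := by abel
        rw [h3]
        refine (norm_sub_le _ _).trans ?_
        linarith [hct K, hct (K + 1), hr K]
      have := h1 K e (c K) (hc K) (c (K + 1)) (hc (K + 1)) hd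
      have h4 := abs_add_le (radSum e (c K)) (radSum e (c (K + 1)) - radSum e (c K))
      rw [add_sub_cancel] at h4
      linarith
  have h5 := abs_radSum_le e (t - c K)
  have h6 : √(Fintype.card ι) * ‖t - c K‖ ≤ √(Fintype.card ι) * r K := by
    gcongr; exact hct K
  rw [radSum_sub] at h5
  have h4 := abs_add_le (radSum e (c K)) (radSum e t - radSum e (c K))
  rw [add_sub_cancel] at h4
  linarith [hchain K]

/-- Dudley's chaining bound for the supremum of Rademacher sums over a set of vectors. -/
theorem sum_iSup_radSum_le [DecidableEq ι] {T : Set (EuclideanSpace ℝ ι)} {ψ : ℝ → ℝ≥0∞}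
    (hψ : Antitone ψ) (hψ1 : ∀ ε, 1 ≤ ψ ε) {S a : ℝ} (hS : 0 < S) (ha : 0 < a)
    (hT : ∀ t ∈ T, ‖t‖ ≤ a * S)
    (hcov : ∀ ε > 0, ψ ε ≠ ⊤ → ∃ C : Finset (EuclideanSpace ℝ ι),
      ENNReal.ofReal √(1 + Real.log C.card) ≤ ψ ε ∧ ∀ t ∈ T, ∃ c ∈ C, ‖t - c‖ ≤ ε * S) :
    ∑ e : ι → Bool, ⨆ t ∈ T, ENNReal.ofReal |radSum e t| ≤
      2 ^ Fintype.card ι * (18 * ENNReal.ofReal S * ∫⁻ ε in Set.Ioo 0 a, ψ ε) := by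
  rcases eq_or_ne (∫⁻ ε in Set.Ioo 0 a, ψ ε) ⊤ with hI | hI
  · rw [hI, ENNReal.mul_top (by simp [hS]), ENNReal.mul_top (by simp)]
    exact le_top
  have hterm : ∀ k : ℕ, ENNReal.ofReal (a / 2 ^ (k + 1)) * ψ (a / 2 ^ k) ≤
      ∫⁻ ε in Set.Ioo 0 a, ψ ε := fun k => le_trans
    (Finset.single_le_sum (f := fun k => ENNReal.ofReal (a / 2 ^ (k + 1)) * ψ (a / 2 ^ k))
      (fun _ _ => zero_le) (Finset.self_mem_range_succ k)) (sum_dyadic_le_lintegral hψ ha (k + 1))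
  -- A finite integral makes ψ finite at every dyadic scale, so nets exist there.
  have hfin : ∀ k : ℕ, ψ (a / 2 ^ k) ≠ ⊤ := by
    intro k hk
    have := hterm k
    rw [hk, ENNReal.mul_top (by simp; positivity)] at this
    exact hI (top_le_iff.1 this)
  have hC : ∀ k : ℕ, ∃ C : Finset (EuclideanSpace ℝ ι),
      ENNReal.ofReal √(1 + Real.log C.card) ≤ ψ (a / 2 ^ k) ∧
      (∀ t ∈ T, ∃ c ∈ C, ‖t - c‖ ≤ a / 2 ^ k * S) ∧ (k = 0 → C = {0}) := by
    intro k
    rcases Nat.eq_zero_or_pos k with rfl | hk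
    -- At scale a the origin alone is a net, and its entropy term √(1 + log 1) = 1 is covered by 1 ≤
    -- ψ.
    · refine ⟨{0}, by simpa using hψ1 _, fun t ht => ⟨0, by simp, ?_⟩, fun _ => rfl⟩
      simpa using hT t ht
    · obtain ⟨C, h1, h2⟩ := hcov (a / 2 ^ k) (by positivity) (hfin k)
      exact ⟨C, h1, h2, fun h => absurd h hk.ne'⟩
  choose C hCψ hCT hC0 using hC
  obtain ⟨m, hm0, hmT, hm⟩ := exists_chain_majorant (T := T) (r := fun k => a / 2 ^ k * S)
    (fun k => by positivity) (fun k => by simp only [pow_succ]; field_simp) C (hC0 0 rfl) hCT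
  have hlink : ∀ k, ∑ e : ι → Bool, ENNReal.ofReal (m k e) ≤ 2 ^ Fintype.card ι *
      (18 * ENNReal.ofReal S * (ENNReal.ofReal (a / 2 ^ (k + 2)) * ψ (a / 2 ^ (k + 1)))) := by
    intro k
    rw [← ENNReal.ofReal_sum_of_nonneg fun e _ => hm0 k e]
    refine (ENNReal.ofReal_le_ofReal (hm k)).trans ?_
    rw [ENNReal.ofReal_mul (by positivity), ENNReal.ofReal_pow (by norm_num),
      ENNReal.ofReal_ofNat]
    gcongr
    -- The index shift trades the net radius for the length of a dyadic interval. The remaining 9 is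
    -- doubled because each link carries two nets, which gives 18.
    have e1 : 3 / 2 * (3 * (a / 2 ^ (k + 1) * S)) = 9 * (S * (a / 2 ^ (k + 2))) := by
      rw [pow_succ _ (k + 1)]; field_simp; norm_num
    rw [e1, ENNReal.ofReal_mul (by positivity), ENNReal.ofReal_add (by positivity) (by positivity),
      ENNReal.ofReal_mul (by positivity), ENNReal.ofReal_mul (by positivity), ENNReal.ofReal_ofNat]
    have hle : ENNReal.ofReal √(1 + Real.log (C k).card) +
        ENNReal.ofReal √(1 + Real.log (C (k + 1)).card) ≤ 2 * ψ (a / 2 ^ (k + 1)) := by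
      rw [two_mul]
      refine add_le_add ((hCψ k).trans (hψ ?_)) (hCψ (k + 1))
      exact div_le_div_of_nonneg_left ha.le (by positivity)
        (pow_le_pow_right₀ (by norm_num) (Nat.le_succ k))
    calc _ ≤ 9 * (ENNReal.ofReal S * ENNReal.ofReal (a / 2 ^ (k + 2))) *
          (2 * ψ (a / 2 ^ (k + 1))) := by gcongr
      _ = (9 * 2) * ENNReal.ofReal S *
          (ENNReal.ofReal (a / 2 ^ (k + 2)) * ψ (a / 2 ^ (k + 1))) := by ring
      _ = _ := by norm_num
  have hK : ∀ K : ℕ, ∑ e : ι → Bool, ⨆ t ∈ T, ENNReal.ofReal |radSum e t| ≤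
      2 ^ Fintype.card ι * (18 * ENNReal.ofReal S * ∫⁻ ε in Set.Ioo 0 a, ψ ε) +
        2 ^ Fintype.card ι * ENNReal.ofReal (√(Fintype.card ι) * (a / 2 ^ K * S)) := by
    intro K
    calc _ ≤ ∑ e : ι → Bool, (∑ k ∈ Finset.range K, ENNReal.ofReal (m k e) +
          ENNReal.ofReal (√(Fintype.card ι) * (a / 2 ^ K * S))) := by
          refine Finset.sum_le_sum fun e _ => iSup₂_le fun t ht => ?_
          rw [← ENNReal.ofReal_sum_of_nonneg fun k _ => hm0 k e,
            ← ENNReal.ofReal_add (Finset.sum_nonneg fun k _ => hm0 k e) (by positivity)]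
          exact ENNReal.ofReal_le_ofReal (hmT K e t ht)
      _ = ∑ k ∈ Finset.range K, ∑ e : ι → Bool, ENNReal.ofReal (m k e) +
          2 ^ Fintype.card ι * ENNReal.ofReal (√(Fintype.card ι) * (a / 2 ^ K * S)) := by
          rw [Finset.sum_add_distrib, Finset.sum_comm, Finset.sum_const, nsmul_eq_mul]
          simp
      _ ≤ _ := by
          gcongr
          refine (Finset.sum_le_sum fun k _ => hlink k).trans ?_
          rw [← Finset.mul_sum, ← Finset.mul_sum]
          gcongr
          have h := sum_dyadic_le_lintegral hψ ha (K + 1)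
          rw [Finset.sum_range_succ'] at h
          exact le_self_add.trans h
  have h0 : Filter.Tendsto (fun K : ℕ => √(Fintype.card ι) * (a / 2 ^ K * S)) Filter.atTop
      (nhds 0) := by
    have h1 : Filter.Tendsto (fun K : ℕ => (1 / 2 : ℝ) ^ K) Filter.atTop (nhds 0) :=
      tendsto_pow_atTop_nhds_zero_of_lt_one (by norm_num) (by norm_num)
    have h2 := h1.const_mul (√(Fintype.card ι) * a * S)
    rw [mul_zero] at h2
    refine h2.congr fun K => ?_
    rw [one_div, inv_pow]; ring
  have h3 := (ENNReal.tendsto_ofReal h0)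
  rw [ENNReal.ofReal_zero] at h3
  have h4 := ENNReal.Tendsto.const_mul (a := (2 : ℝ≥0∞) ^ Fintype.card ι) h3 (Or.inr (by simp))
  rw [mul_zero] at h4
  have h5 := h4.const_add
    (2 ^ Fintype.card ι * (18 * ENNReal.ofReal S * ∫⁻ ε in Set.Ioo 0 a, ψ ε))
  rw [add_zero] at h5
  exact ge_of_tendsto' h5 hK

end Chaining

/-! ### Finitely discrete measures, covering numbers and the entropy integrand. -/

section Covering

theorem one_le_sqrtOneAddLog (N : ℕ∞) : 1 ≤ sqrtOneAddLog N := by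
  unfold sqrtOneAddLog
  split_ifs
  · exact le_top
  · rw [← ENNReal.ofReal_one]
    refine ENNReal.ofReal_le_ofReal (Real.one_le_sqrt.2 ?_)
    linarith [Real.log_natCast_nonneg N.toNat]

theorem sqrt_one_add_log_mono {m n : ℕ} (h : m ≤ n) :
    √(1 + Real.log m) ≤ √(1 + Real.log n) := by
  refine Real.sqrt_le_sqrt ?_
  gcongr 1 + ?_
  rcases Nat.eq_zero_or_pos m with rfl | hm
  · simpa using Real.log_natCast_nonneg n
  · exact Real.log_le_log (by exact_mod_cast hm) (by exact_mod_cast h)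

theorem sqrtOneAddLog_mono : Monotone sqrtOneAddLog := by
  intro M N h
  unfold sqrtOneAddLog
  split_ifs with h1 h2 h2
  · exact le_rfl
  · exact absurd (top_le_iff.1 (h1 ▸ h)) h2
  · exact le_top
  · exact ENNReal.ofReal_le_ofReal (sqrt_one_add_log_mono (ENat.toNat_le_toNat h h2))

variable {X : Type*} [MeasurableSpace X] {ι : Type*} [Fintype ι]

/-- The discrete measure with mass `uᵢ` at the point `xᵢ`. -/
noncomputable def weightedDirac (u : ι → ℝ) (x : ι → X) : Measure X :=
  ∑ i, ENNReal.ofReal (u i) • Measure.dirac (x i)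

/-- Sample points may coincide, so the weights are collected over the fibres of `x`. -/
theorem isFinitelyDiscrete_weightedDirac {u : ι → ℝ} (hu : ∀ i, 0 ≤ u i) (hu1 : ∑ i, u i = 1)
    (x : ι → X) : IsFinitelyDiscrete (weightedDirac u x) := by
  classical
  refine ⟨⟨?_⟩, Finset.univ.image x,
    fun y => ∑ i with x i = y, ENNReal.ofReal (u i), ?_⟩
  · simp only [weightedDirac, Measure.coe_finsetSum, Finset.sum_apply, Measure.smul_apply,
      measure_univ, smul_eq_mul, mul_one]
    rw [← ENNReal.ofReal_sum_of_nonneg fun i _ => hu i, hu1, ENNReal.ofReal_one]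
  · simp only [weightedDirac, Finset.sum_smul]
    rw [← Finset.sum_fiberwise_of_maps_to
      (fun i _ => Finset.mem_image_of_mem x (Finset.mem_univ i))]
    refine Finset.sum_congr rfl fun y _ => Finset.sum_congr rfl fun i hi => ?_
    rw [(Finset.mem_filter.1 hi).2]

theorem eLpNorm_weightedDirac {u : ι → ℝ} (hu : ∀ i, 0 ≤ u i) (x : ι → X) {h : X → ℝ}
    (hh : Measurable h) :
    eLpNorm h 2 (weightedDirac u x) = ENNReal.ofReal √(∑ i, u i * h (x i) ^ 2) := by
  rw [eLpNorm_eq_lintegral_rpow_enorm_toReal (by norm_num) (by norm_num), weightedDirac,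
    lintegral_finsetSum_measure, Real.sqrt_eq_rpow,
    ← ENNReal.ofReal_rpow_of_nonneg
      (Finset.sum_nonneg fun i _ => mul_nonneg (hu i) (sq_nonneg _)) (by norm_num),
    ENNReal.ofReal_sum_of_nonneg fun i _ => mul_nonneg (hu i) (sq_nonneg _)]
  norm_num
  congr 1
  refine Finset.sum_congr rfl fun i _ => ?_
  rw [lintegral_dirac' _ (by fun_prop), ENNReal.ofReal_mul (hu i), Real.enorm_eq_ofReal_abs,
    ← ENNReal.ofReal_pow (abs_nonneg _), sq_abs]

theorem antitone_sqrtOneAddLog_coveringNumberL2 {Q : Measure X} {ℱ : Set (X → ℝ)} {F : X → ℝ}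
    (hF : eLpNorm F 2 Q ≠ ⊤) :
    Antitone fun ε : ℝ =>
      sqrtOneAddLog (coveringNumberL2 Q ℱ (ENNReal.ofReal ε * eLpNorm F 2 Q).toNNReal) := by
  intro r s hrs
  refine sqrtOneAddLog_mono (Metric.externalCoveringNumber_anti ?_)
  refine ENNReal.toNNReal_mono (ENNReal.mul_ne_top (by simp) hF) ?_
  gcongr

/-- Turns a net of `Lp` classes into a finite set of functions. Measurable representatives suffice,
since under a weighted Dirac sum the norm of a measurable function is a pointwise sum. -/
theorem exists_finset_of_coveringNumberL2 {u : ι → ℝ} (hu : ∀ i, 0 ≤ u i) (x : ι → X)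
    {ℱ : Set (X → ℝ)} (hℱ : ∀ f ∈ ℱ, Measurable f) {F : X → ℝ} (hF : Measurable F)
    {ε : ℝ} (hε : 0 < ε)
    (hN : coveringNumberL2 (weightedDirac u x) ℱ
      (ENNReal.ofReal ε * eLpNorm F 2 (weightedDirac u x)).toNNReal ≠ ⊤) :
    ∃ C : Finset (X → ℝ), C.card ≤ (coveringNumberL2 (weightedDirac u x) ℱ
      (ENNReal.ofReal ε * eLpNorm F 2 (weightedDirac u x)).toNNReal).toNat ∧
      ∀ f ∈ ℱ, ∃ g ∈ C,
        √(∑ i, u i * (f (x i) - g (x i)) ^ 2) ≤ ε * √(∑ i, u i * F (x i) ^ 2) := by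
  classical
  set Q := weightedDirac u x with hQ
  set r := (ENNReal.ofReal ε * eLpNorm F 2 Q).toNNReal with hr
  set N := coveringNumberL2 Q ℱ r with hNdef
  -- A near-minimizer within 1 of the infimum has cardinality at most N, since N is finite.
  have hlt : N < N + 1 := 
    (Order.lt_add_one_iff_of_not_isMax (by simpa using hN)).2 le_rfl
  obtain ⟨C, hC⟩ := iInf_lt_iff.1 (lt_of_eq_of_lt hNdef.symm hlt)
  obtain ⟨hcov, hcard⟩ := iInf_lt_iff.1 hC
  have hcard' : C.encard ≤ N := Order.lt_add_one_iff_of_not_isMax (by simpa using hN) |>.1 hcard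
  have hfin : C.Finite := Set.finite_of_encard_le_coe
    (hcard'.trans (ENat.natCast_toNat hN).symm.le)
  refine ⟨hfin.toFinset.image fun g : Lp ℝ 2 Q => (g : X → ℝ), ?_, fun f hf => ?_⟩
  · refine Finset.card_image_le.trans ?_
    rw [← Set.ncard_eq_toFinset_card C hfin, Set.ncard]
    exact ENat.toNat_le_toNat hcard' hN
  · have hmem : MemLp f 2 Q := ⟨(hℱ f hf).aestronglyMeasurable, by
      rw [hQ, eLpNorm_weightedDirac hu x (hℱ f hf)]; exact ENNReal.ofReal_lt_top⟩
    obtain ⟨g, hgC, hg⟩ := hcov (show hmem.toLp f ∈ {g : Lp ℝ 2 Q | ∃ f ∈ ℱ, (g : X → ℝ) =ᵐ[Q] f}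
      from ⟨f, hf, hmem.coeFn_toLp⟩)
    refine ⟨g, Finset.mem_image.2 ⟨g, by simpa using hgC, rfl⟩, ?_⟩
    have hgm : Measurable (g : X → ℝ) := (Lp.stronglyMeasurable g).measurable
    have h1 : edist (hmem.toLp f) g ≤ r := hg
    have h2 : eLpNorm (f - (g : X → ℝ)) 2 Q = _ := eLpNorm_weightedDirac hu x ((hℱ f hf).sub hgm)
    have h3 : eLpNorm F 2 Q = _ := eLpNorm_weightedDirac hu x hF
    rw [Lp.edist_def, eLpNorm_congr_ae (hmem.coeFn_toLp.sub (ae_eq_refl _)), h2, hr, h3,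
      ENNReal.coe_toNNReal (by finiteness), ← ENNReal.ofReal_mul hε.le,
      ENNReal.ofReal_le_ofReal_iff (by positivity)] at h1
    simpa using h1

/-- Monotonicity gives ∫₀ᵃ ψ ≤ ∫₀ᵇ ψ + a ψ(b) and b ψ(b) ≤ ∫₀ᵇ ψ. This replaces a sample-dependent
radius by a deterministic one, at a cost linear in the radius. -/
theorem lintegral_Ioo_le_mul {ψ : ℝ → ℝ≥0∞} (hψ : Antitone ψ) {a b : ℝ} (ha : 0 < a)
    (hb : 0 < b) :
    ∫⁻ ε in Set.Ioo 0 a, ψ ε ≤ ENNReal.ofReal (1 + a / b) * ∫⁻ ε in Set.Ioo 0 b, ψ ε := by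
  have hsub : Set.Ioo 0 a ⊆ Set.Ioo 0 b ∪ Set.Ico b (b + a) := by
    intro y hy
    rcases lt_or_ge y b with h | h
    · exact Or.inl ⟨hy.1, h⟩
    · exact Or.inr ⟨h, by linarith [hy.2]⟩
  have hb' : ENNReal.ofReal b * ψ b ≤ ∫⁻ ε in Set.Ioo 0 b, ψ ε := by
    calc ENNReal.ofReal b * ψ b = ∫⁻ _ in Set.Ioo 0 b, ψ b := by
          rw [setLIntegral_const, Real.volume_Ioo, mul_comm, sub_zero]
      _ ≤ _ := setLIntegral_mono' measurableSet_Ioo fun x hx => hψ hx.2.le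
  have ha' : ∫⁻ ε in Set.Ico b (b + a), ψ ε ≤ ENNReal.ofReal a * ψ b := by
    calc _ ≤ ∫⁻ _ in Set.Ico b (b + a), ψ b :=
          setLIntegral_mono' measurableSet_Ico fun x hx => hψ hx.1
      _ = _ := by rw [setLIntegral_const, Real.volume_Ico, mul_comm, add_sub_cancel_left]
  have e : a = a / b * b := by field_simp
  calc _ ≤ ∫⁻ ε in Set.Ioo 0 b ∪ Set.Ico b (b + a), ψ ε := lintegral_mono_set hsub
    _ ≤ (∫⁻ ε in Set.Ioo 0 b, ψ ε) + ∫⁻ ε in Set.Ico b (b + a), ψ ε := lintegral_union_le _ _ _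
    _ ≤ (∫⁻ ε in Set.Ioo 0 b, ψ ε) + ENNReal.ofReal a * ψ b := by gcongr
    _ = (∫⁻ ε in Set.Ioo 0 b, ψ ε) + ENNReal.ofReal (a / b) * (ENNReal.ofReal b * ψ b) := by
      rw [← mul_assoc, ← ENNReal.ofReal_mul (by positivity), ← e]
    _ ≤ (∫⁻ ε in Set.Ioo 0 b, ψ ε) + ENNReal.ofReal (a / b) * ∫⁻ ε in Set.Ioo 0 b, ψ ε := by
      gcongr
    _ = _ := by
      rw [ENNReal.ofReal_add (by norm_num) (by positivity), ENNReal.ofReal_one, add_mul, one_mul]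

end Covering

/-! ### Conditional chaining bounds for ℱ and for its squares. -/

section Entropy

variable {X : Type*} [MeasurableSpace X] {ι : Type*} [Fintype ι] [DecidableEq ι]

/-- Dudley's bound in terms of the uniform entropy integral, for the image of a class of functions
under a map which is Lipschitz for a weighted empirical `L₂`-norm. -/
theorem sum_iSup_radSum_le_uniformEntropyIntegral {ℱ : Set (X → ℝ)}
    (hℱ : ∀ f ∈ ℱ, Measurable f) {F : X → ℝ} (hF : Measurable F) (x : ι → X) {v : ι → ℝ}
    (hv : ∀ i, 0 ≤ v i) (Φ c : (X → ℝ) → EuclideanSpace ℝ ι) {κ D b : ℝ} (hκ : 0 < κ)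
    (hb : 0 < b)
    (hΦc : ∀ f ∈ ℱ, ∀ g : X → ℝ, ‖Φ f - c g‖ ≤ κ * √(∑ i, v i * (f (x i) - g (x i)) ^ 2))
    (hΦS : ∀ f ∈ ℱ, ‖Φ f‖ ≤ κ * √(∑ i, v i * F (x i) ^ 2)) (hΦD : ∀ f ∈ ℱ, ‖Φ f‖ ≤ D) :
    ∑ e : ι → Bool, ⨆ f ∈ ℱ, ENNReal.ofReal |radSum e (Φ f)| ≤ 2 ^ Fintype.card ι *
      (18 * ENNReal.ofReal (κ * √(∑ i, v i * F (x i) ^ 2) + D / b) *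
        uniformEntropyIntegral ℱ F b) := by
  classical
  by_cases hpos : 0 < κ * √(∑ i, v i * F (x i) ^ 2) ∧ 0 < D
  swap
  · have hz : ∀ f ∈ ℱ, Φ f = 0 := by
      intro f hf
      rw [← norm_le_zero_iff]
      rcases not_and_or.1 hpos with h | h
      · exact (hΦS f hf).trans (not_lt.1 h)
      · exact (hΦD f hf).trans (not_lt.1 h)
    refine le_trans (le_of_eq ?_) zero_le
    refine Finset.sum_eq_zero fun e _ => ?_
    simp only [ENNReal.iSup_eq_zero]
    intro f hf
    simp [hz f hf, radSum]
  obtain ⟨hS, hD⟩ := hpos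
  set S := κ * √(∑ i, v i * F (x i) ^ 2) with hSdef
  have hW : 0 < ∑ i, v i := by
    refine (Finset.sum_nonneg fun i _ => hv i).lt_of_ne' fun h0 => ?_
    have h1 := (Finset.sum_eq_zero_iff_of_nonneg fun i _ => hv i).1 h0
    rw [hSdef, Finset.sum_eq_zero fun i hi => by rw [h1 i hi, zero_mul]] at hS
    simp at hS
  set W := ∑ i, v i with hWdef
  have hu : ∀ i, 0 ≤ v i / W := fun i => div_nonneg (hv i) hW.le
  have hu1 : ∑ i, v i / W = 1 := by rw [← Finset.sum_div, ← hWdef, div_self hW.ne']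
  -- Normalizing the weights to a probability divides both sides of the covering inequality by √W,
  -- so nets for Q serve the weighted norm.
  have hscale : ∀ h : ι → ℝ, √(∑ i, v i / W * h i ^ 2) = √(∑ i, v i * h i ^ 2) / √W := by
    intro h
    rw [← Real.sqrt_div' _ hW.le, Finset.sum_div]
    congr 1
    exact Finset.sum_congr rfl fun i _ => by ring
  set Q := weightedDirac (fun i => v i / W) x with hQ
  have hQfin : IsFinitelyDiscrete Q := isFinitelyDiscrete_weightedDirac hu hu1 x
  have hFfin : eLpNorm F 2 Q ≠ ⊤ := by
    rw [hQ, eLpNorm_weightedDirac hu x hF]; exact ENNReal.ofReal_ne_top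
  set ψ : ℝ → ℝ≥0∞ := fun ε =>
    sqrtOneAddLog (coveringNumberL2 Q ℱ (ENNReal.ofReal ε * eLpNorm F 2 Q).toNNReal) with hψdef
  have hψ : Antitone ψ := antitone_sqrtOneAddLog_coveringNumberL2 hFfin
  have hcov : ∀ ε > 0, ψ ε ≠ ⊤ → ∃ C : Finset (EuclideanSpace ℝ ι),
      ENNReal.ofReal √(1 + Real.log C.card) ≤ ψ ε ∧
        ∀ t ∈ Φ '' ℱ, ∃ c ∈ C, ‖t - c‖ ≤ ε * S := by
    intro ε hε hfin
    have hN : coveringNumberL2 Q ℱ (ENNReal.ofReal ε * eLpNorm F 2 Q).toNNReal ≠ ⊤ := by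
      exact fun h => hfin (by simp only [hψdef, sqrtOneAddLog, if_pos h])
    obtain ⟨C, hcard, hC⟩ := exists_finset_of_coveringNumberL2 hu x hℱ hF hε hN
    refine ⟨C.image c, ?_, ?_⟩
    · simp only [hψdef, sqrtOneAddLog, if_neg hN]
      exact ENNReal.ofReal_le_ofReal
        (sqrt_one_add_log_mono (Finset.card_image_le.trans hcard))
    · rintro _ ⟨f, hf, rfl⟩
      obtain ⟨g, hg, hfg⟩ := hC f hf
      refine ⟨c g, Finset.mem_image_of_mem c hg, (hΦc f hf g).trans ?_⟩
      rw [hscale fun i => f (x i) - g (x i), hscale fun i => F (x i), ← mul_div_assoc,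
        div_le_div_iff_of_pos_right (Real.sqrt_pos.2 hW)] at hfg
      calc _ ≤ κ * (ε * √(∑ i, v i * F (x i) ^ 2)) := by gcongr
        _ = ε * S := by rw [hSdef]; ring
  have hT : ∀ t ∈ Φ '' ℱ, ‖t‖ ≤ D / S * S := by
    rintro _ ⟨f, hf, rfl⟩
    rw [div_mul_cancel₀ _ hS.ne']
    exact hΦD f hf
  have hmain := sum_iSup_radSum_le (T := Φ '' ℱ) hψ (fun ε => one_le_sqrtOneAddLog _) hS
    (div_pos hD hS) hT hcov
  simp only [iSup_image] at hmain
  refine hmain.trans ?_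
  gcongr 2 ^ Fintype.card ι * ?_
  have hJ : ∫⁻ ε in Set.Ioo 0 b, ψ ε ≤ uniformEntropyIntegral ℱ F b :=
    le_iSup₂ (f := fun (Q : Measure X) (_ : IsFinitelyDiscrete Q) => ∫⁻ ε in Set.Ioo 0 b,
      sqrtOneAddLog (coveringNumberL2 Q ℱ (ENNReal.ofReal ε * eLpNorm F 2 Q).toNNReal)) Q hQfin
  calc _ ≤ 18 * ENNReal.ofReal S *
        (ENNReal.ofReal (1 + D / S / b) * uniformEntropyIntegral ℱ F b) := by
        gcongr
        refine (lintegral_Ioo_le_mul hψ (div_pos hD hS) hb).trans ?_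
        gcongr
    _ = 18 * (ENNReal.ofReal S * ENNReal.ofReal (1 + D / S / b)) *
        uniformEntropyIntegral ℱ F b := by ring
    _ = _ := by
        rw [← ENNReal.ofReal_mul hS.le]
        congr 3
        field_simp

/-- The conditional bound for the symmetrized empirical process indexed by `ℱ`. -/
theorem sum_iSup_le_uniformEntropyIntegral {ℱ : Set (X → ℝ)} (hℱ : ∀ f ∈ ℱ, Measurable f)
    {F : X → ℝ} (hF : IsEnvelope ℱ F) (x : ι → X) {D b : ℝ} (hb : 0 < b)
    (hD : ∀ f ∈ ℱ, √(∑ i, f (x i) ^ 2) ≤ D) :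
    ∑ e : ι → Bool, ⨆ f ∈ ℱ, ENNReal.ofReal |∑ i, boolSign (e i) * f (x i)| ≤
      2 ^ Fintype.card ι * (18 * ENNReal.ofReal (√(∑ i, F (x i) ^ 2) + D / b) *
        uniformEntropyIntegral ℱ F b) := by
  have h := sum_iSup_radSum_le_uniformEntropyIntegral hℱ hF.measurable x (v := fun _ => 1)
    (fun _ => zero_le_one) (fun f => WithLp.toLp 2 fun i => f (x i))
    (fun f => WithLp.toLp 2 fun i => f (x i)) (κ := 1) (D := D) one_pos hb
    (fun f _ g => by simp [EuclideanSpace.norm_eq])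
    (fun f hf => by
      simp only [EuclideanSpace.norm_eq, one_mul, Real.norm_eq_abs]
      gcongr with i
      exact hF.abs_le f hf _)
    (fun f hf => by simpa [EuclideanSpace.norm_eq] using hD f hf)
  simpa [radSum] using h

/-- Projection onto [-c, c] does not increase the distance to a, and squaring is 2c-Lipschitz there.
The clamp is needed because centres of covering balls need not obey the envelope. -/
theorem abs_sq_sub_sq_clamp_le {a b c : ℝ} (ha : |a| ≤ c) :
    |a ^ 2 - max (-c) (min c b) ^ 2| ≤ 2 * c * |a - b| := by
  obtain ⟨h1, h2⟩ := abs_le.1 ha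
  have hc : 0 ≤ c := (abs_nonneg a).trans ha
  have hm1 : -c ≤ max (-c) (min c b) := le_max_left _ _
  have hm2 : max (-c) (min c b) ≤ c := max_le (by linarith) (min_le_left _ _)
  have hd : |a - max (-c) (min c b)| ≤ |a - b| := by
    rcases le_total c b with h | h
    · rw [min_eq_left h, max_eq_right (by linarith), abs_of_nonpos (by linarith),
        abs_of_nonpos (by linarith)]
      linarith
    · rw [min_eq_right h]
      rcases le_total (-c) b with h' | h'
      · rw [max_eq_right h']
      · rw [max_eq_left h', abs_of_nonneg (by linarith), abs_of_nonneg (by linarith)]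
        linarith
  have hs : |a + max (-c) (min c b)| ≤ 2 * c := by
    rw [abs_le]; constructor <;> linarith
  rw [sq_sub_sq, abs_mul]
  exact mul_le_mul hs hd (abs_nonneg _) (by positivity)

/-- The conditional bound for the symmetrized empirical process indexed by the squares of `ℱ`. -/
theorem sum_iSup_sq_le_uniformEntropyIntegral {ℱ : Set (X → ℝ)} (hℱ : ∀ f ∈ ℱ, Measurable f)
    {F : X → ℝ} (hF : IsEnvelope ℱ F) (x : ι → X) {D b : ℝ} (hb : 0 < b)
    (hD : ∀ f ∈ ℱ, √(∑ i, f (x i) ^ 4) ≤ D) :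
    ∑ e : ι → Bool, ⨆ f ∈ ℱ, ENNReal.ofReal |∑ i, boolSign (e i) * f (x i) ^ 2| ≤
      2 ^ Fintype.card ι * (18 * ENNReal.ofReal (2 * √(∑ i, F (x i) ^ 4) + D / b) *
        uniformEntropyIntegral ℱ F b) := by
  have hF4 : ∑ i, F (x i) ^ 2 * F (x i) ^ 2 = ∑ i, F (x i) ^ 4 :=
    Finset.sum_congr rfl fun i _ => by ring
  have hle : ∀ f ∈ ℱ, ∀ y, f y ^ 4 ≤ F y ^ 4 := fun f hf y => by
    have := pow_le_pow_left₀ (abs_nonneg _) (hF.abs_le f hf y) 4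
    rwa [Even.pow_abs (by decide)] at this
  -- The pointwise Lipschitz constant 2F becomes κ = 2 and the weight F², so the envelope
  -- contributes ∑ F² · F².
  have h := sum_iSup_radSum_le_uniformEntropyIntegral hℱ hF.measurable x
    (v := fun i => F (x i) ^ 2)
    (fun _ => sq_nonneg _) (fun f => WithLp.toLp 2 fun i => f (x i) ^ 2)
    (fun g => WithLp.toLp 2 fun i => max (-F (x i)) (min (F (x i)) (g (x i))) ^ 2)
    (κ := 2) (D := D) two_pos hb
    (fun f hf g => by
      rw [EuclideanSpace.norm_eq, ← Real.sqrt_sq (zero_le_two (α := ℝ)),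
        ← Real.sqrt_mul (by positivity), Finset.mul_sum]
      refine Real.sqrt_le_sqrt (Finset.sum_le_sum fun i _ => ?_)
      have h1 := pow_le_pow_left₀ (abs_nonneg _)
        (abs_sq_sub_sq_clamp_le (b := g (x i)) (hF.abs_le f hf (x i))) 2
      rw [mul_pow, mul_pow, sq_abs (f (x i) - g (x i))] at h1
      simpa [mul_assoc] using h1)
    (fun f hf => by
      rw [EuclideanSpace.norm_eq, hF4]
      refine le_trans (Real.sqrt_le_sqrt (Finset.sum_le_sum (g := fun i => F (x i) ^ 4)
        fun i _ => ?_)) ?_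
      · simpa [← pow_mul] using hle f hf (x i)
      · linarith [Real.sqrt_nonneg (∑ i, F (x i) ^ 4)])
    (fun f hf => by
      simpa [EuclideanSpace.norm_eq, ← pow_mul] using hD f hf)
  rw [hF4] at h
  simpa [radSum] using h

end Entropy

/-! ### Symmetrization with a ghost sample. -/

section Symmetrization

variable {X ι κ : Type*} [Fintype ι] [Fintype κ]

/-- The supremum `sup_{f ∈ ℱ} |∑ᵢ eᵢ f(xᵢ)|` as an element of `[0,∞]`. -/
noncomputable def signedSup (ℱ : Set (X → ℝ)) (e : ι → ℝ) (x : ι → X) : ℝ≥0∞ :=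
  ⨆ f ∈ ℱ, ENNReal.ofReal |∑ i, e i * f (x i)|

theorem signedSup_comp_equiv (ℱ : Set (X → ℝ)) (φ : ι ≃ κ) (e : κ → ℝ) (x : ι → X) :
    signedSup ℱ (e ∘ φ) x = signedSup ℱ e (x ∘ φ.symm) := by
  unfold signedSup
  congr! 6 with f hf
  rw [← φ.sum_comp]
  simp

theorem signedSup_neg (ℱ : Set (X → ℝ)) (e : ι → ℝ) (x : ι → X) :
    signedSup ℱ (-e) x = signedSup ℱ e x := by
  simp [signedSup]

theorem signedSup_sumElim_le (ℱ : Set (X → ℝ)) (s : ι → ℝ) (t : κ → ℝ) (z : ι ⊕ κ → X) :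
    signedSup ℱ (Sum.elim s t) z ≤
      signedSup ℱ s (fun i => z (Sum.inl i)) + signedSup ℱ t (fun i => z (Sum.inr i)) := by
  refine iSup₂_le fun f hf => ?_
  rw [Fintype.sum_sum_type]
  refine (ENNReal.ofReal_le_ofReal (abs_add_le _ _)).trans ?_
  rw [ENNReal.ofReal_add (abs_nonneg _) (abs_nonneg _)]
  exact add_le_add
    (le_iSup₂ (f := fun (f : X → ℝ) (_ : f ∈ ℱ) =>
      ENNReal.ofReal |∑ i, s i * f (z (Sum.inl i))|) f hf)
    (le_iSup₂ (f := fun (f : X → ℝ) (_ : f ∈ ℱ) =>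
      ENNReal.ofReal |∑ i, t i * f (z (Sum.inr i))|) f hf)

/-- The permutation exchanging the two copies of those indices at which `e` is not `1`. -/
noncomputable def exchange {ι : Type*} (e : ι → ℝ) : Equiv.Perm (ι ⊕ ι) :=
  open Classical in
  Function.Involutive.toPerm
    (Sum.elim (fun i => if e i = 1 then Sum.inl i else Sum.inr i)
      (fun i => if e i = 1 then Sum.inr i else Sum.inl i)) (by
      rintro (i | i) <;> by_cases hi : e i = 1 <;> simp [hi])

theorem sumElim_comp_exchange {ι : Type*} {e : ι → ℝ} (he : ∀ i, e i = 1 ∨ e i = -1) :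
    (Sum.elim 1 (-1) : ι ⊕ ι → ℝ) ∘ exchange e = Sum.elim e (-e) := by
  ext (i | i) <;> rcases he i with hi | hi <;>
    norm_num [exchange, Function.Involutive.toPerm, hi]

variable [MeasurableSpace X]

theorem measurePreserving_comp_equiv (P : Measure X) [IsProbabilityMeasure P] (φ : ι ≃ κ) :
    MeasurePreserving (fun x : ι → X => x ∘ φ.symm) (Measure.pi fun _ : ι => P)
      (Measure.pi fun _ : κ => P) := by
  have h := measurePreserving_piCongrLeft (fun _ : κ => P) φ
  convert h using 2 with x
  ext j
  obtain ⟨i, rfl⟩ := φ.surjective j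
  exact (congrArg x (φ.symm_apply_apply i)).trans
    (MeasurableEquiv.piCongrLeft_apply_apply (β := fun _ => X) φ x i).symm

/-- The definition speaks of `Fin n`; relabelling carries it to any finite index type, in particular
to the doubled sample `ι ⊕ ι`. -/
theorem IsPMeasurable.aemeasurable {P : Measure X} [IsProbabilityMeasure P] {ℱ : Set (X → ℝ)}
    (h : IsPMeasurable P ℱ) {e : ι → ℝ} (he : ∀ i, e i = 1 ∨ e i = -1) :
    AEMeasurable (signedSup ℱ e) (Measure.pi fun _ : ι => P) := by
  have h1 := (h (Fintype.card ι) (e ∘ (Fintype.equivFin ι).symm) fun i => he _).aemeasurable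
  have h2 := h1.comp_quasiMeasurePreserving
    (measurePreserving_comp_equiv P (Fintype.equivFin ι)).quasiMeasurePreserving
  refine h2.congr (Filter.Eventually.of_forall fun x => ?_)
  have h3 := signedSup_comp_equiv ℱ (Fintype.equivFin ι) (e ∘ (Fintype.equivFin ι).symm) x
  rw [Function.comp_assoc, Equiv.symm_comp_self, Function.comp_id] at h3
  exact h3.symm

theorem lintegral_signedSup_comp_perm {P : Measure X} [IsProbabilityMeasure P]
    {ℱ : Set (X → ℝ)} (h : IsPMeasurable P ℱ) (σ : Equiv.Perm ι) {e : ι → ℝ}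
    (he : ∀ i, e i = 1 ∨ e i = -1) :
    ∫⁻ x, signedSup ℱ (e ∘ σ) x ∂(Measure.pi fun _ : ι => P) =
      ∫⁻ x, signedSup ℱ e x ∂(Measure.pi fun _ : ι => P) := by
  have hmp := measurePreserving_comp_equiv P σ
  simp only [signedSup_comp_equiv]
  rw [← lintegral_map' (f := signedSup ℱ e) (by rw [hmp.map_eq]; exact h.aemeasurable he)
    hmp.measurable.aemeasurable, hmp.map_eq]

theorem measurePreserving_comp_inl (P : Measure X) [IsProbabilityMeasure P] :
    MeasurePreserving (fun (z : ι ⊕ κ → X) i => z (Sum.inl i)) (Measure.pi fun _ : ι ⊕ κ => P)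
      (Measure.pi fun _ : ι => P) :=
  measurePreserving_fst.comp (measurePreserving_sumPiEquivProdPi fun _ : ι ⊕ κ => P)

theorem measurePreserving_comp_inr (P : Measure X) [IsProbabilityMeasure P] :
    MeasurePreserving (fun (z : ι ⊕ κ → X) i => z (Sum.inr i)) (Measure.pi fun _ : ι ⊕ κ => P)
      (Measure.pi fun _ : κ => P) :=
  measurePreserving_snd.comp (measurePreserving_sumPiEquivProdPi fun _ : ι ⊕ κ => P)

theorem lintegral_comp_measurePreserving {α β : Type*} [MeasurableSpace α] [MeasurableSpace β]
    {μ : Measure α} {ν : Measure β} {g : α → β} (hg : MeasurePreserving g μ ν)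
    {f : β → ℝ≥0∞} (hf : AEMeasurable f ν) : ∫⁻ a, f (g a) ∂μ = ∫⁻ b, f b ∂ν := by
  rw [← lintegral_map' (by rwa [hg.map_eq]) hg.measurable.aemeasurable, hg.map_eq]

/-- Swapping the i-th point with its ghost copy preserves the product law and turns the signs (1,
-1) into (e, -e). The triangle inequality then splits the two samples. -/
theorem lintegral_signedSup_one_neg_one_le {P : Measure X} [IsProbabilityMeasure P]
    {ℱ : Set (X → ℝ)} (h : IsPMeasurable P ℱ) {e : ι → ℝ} (he : ∀ i, e i = 1 ∨ e i = -1) :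
    ∫⁻ z, signedSup ℱ (Sum.elim 1 (-1) : ι ⊕ ι → ℝ) z ∂(Measure.pi fun _ : ι ⊕ ι => P) ≤
      2 * ∫⁻ x, signedSup ℱ e x ∂(Measure.pi fun _ : ι => P) := by
  rw [← lintegral_signedSup_comp_perm h (exchange e) (by rintro (i | i) <;> simp),
    sumElim_comp_exchange he]
  refine (lintegral_mono fun z => signedSup_sumElim_le ℱ e (-e) z).trans ?_
  simp only [signedSup_neg]
  have hm : AEMeasurable (fun z : ι ⊕ ι → X => signedSup ℱ e fun i => z (Sum.inl i))
      (Measure.pi fun _ : ι ⊕ ι => P) := (h.aemeasurable he).comp_quasiMeasurePreserving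
    (measurePreserving_comp_inl P).quasiMeasurePreserving
  rw [lintegral_add_left' hm,
    lintegral_comp_measurePreserving (measurePreserving_comp_inl P) (h.aemeasurable he),
    lintegral_comp_measurePreserving (measurePreserving_comp_inr P) (h.aemeasurable he), two_mul]

/-- Take a measurable version and set it to ∞ on a measurable null set containing all disagreements.
-/
theorem exists_measurable_majorant {α : Type*} [MeasurableSpace α] {μ : Measure α}
    {f : α → ℝ≥0∞} (hf : AEMeasurable f μ) :
    ∃ g : α → ℝ≥0∞, Measurable g ∧ (∀ a, f a ≤ g a) ∧ ∫⁻ a, g a ∂μ = ∫⁻ a, f a ∂μ := by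
  classical
  set N := toMeasurable μ {a | f a ≠ hf.mk f a} with hN
  have hN0 : μ N = 0 := by
    rw [hN, measure_toMeasurable]
    exact hf.ae_eq_mk
  refine ⟨N.piecewise (fun _ => ⊤) (hf.mk f),
    measurable_const.piecewise (measurableSet_toMeasurable _ _) hf.measurable_mk,
    fun a => ?_, lintegral_congr_ae ?_⟩
  · by_cases ha : a ∈ N
    · simp [ha]
    · rw [Set.piecewise_eq_of_notMem _ _ _ ha]
      by_contra! h
      exact ha (subset_toMeasurable _ _ h.ne')
  · have : ∀ᵐ a ∂μ, a ∉ N := measure_eq_zero_iff_ae_notMem.1 hN0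
    filter_upwards [this, hf.ae_eq_mk] with a ha hfa
    rw [Set.piecewise_eq_of_notMem _ _ _ ha, hfa]

/-- Symmetrization: the centred process has a measurable majorant whose expectation is bounded by
twice the expectation of the symmetrized process, for every choice of signs. -/
theorem exists_majorant_centered {P : Measure X} [IsProbabilityMeasure P]
    {ℱ : Set (X → ℝ)} (h : IsPMeasurable P ℱ) (hint : ∀ f ∈ ℱ, Integrable f P) :
    ∃ U : (ι → X) → ℝ≥0∞, Measurable U ∧
      (∀ x, ⨆ f ∈ ℱ, ENNReal.ofReal |∑ i, (f (x i) - ∫ y, f y ∂P)| ≤ U x) ∧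
      ∀ e : ι → ℝ, (∀ i, e i = 1 ∨ e i = -1) →
        ∫⁻ x, U x ∂(Measure.pi fun _ : ι => P) ≤
          2 * ∫⁻ x, signedSup ℱ e x ∂(Measure.pi fun _ : ι => P) := by
  obtain ⟨H, hHm, hH, hHint⟩ := exists_measurable_majorant
    (h.aemeasurable (ι := ι ⊕ ι) (e := Sum.elim 1 (-1)) (by rintro (i | i) <;> simp))
  set E := MeasurableEquiv.sumPiEquivProdPi (fun _ : ι ⊕ ι => X)
  have hE := measurePreserving_sumPiEquivProdPi_symm (fun _ : ι ⊕ ι => P)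
  have hHE : Measurable fun q : (ι → X) × (ι → X) => H (E.symm q) :=
    hHm.comp E.symm.measurable
  -- The ghost sample is integrated out. Measurability is Tonelli for the measurable H, and the
  -- pointwise bound is |∫ g| ≤ ∫ |g|.
  refine ⟨fun x => ∫⁻ y, H (E.symm (x, y)) ∂(Measure.pi fun _ : ι => P),
    hHE.lintegral_prod_right', fun x => iSup₂_le fun f hf => ?_, fun e he => ?_⟩
  · have hi : ∀ i, Integrable (fun y : ι → X => f (y i)) (Measure.pi fun _ : ι => P) :=
      fun i => (measurePreserving_eval (fun _ : ι => P) i).integrable_comp_of_integrable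
        (hint f hf)
    have hev : ∀ i, ∫ y : ι → X, f (y i) ∂(Measure.pi fun _ : ι => P) = ∫ y, f y ∂P := fun i =>
      integral_comp_eval (μ := fun _ : ι => P) (hint f hf).aestronglyMeasurable
    have heq : ∑ i, (f (x i) - ∫ y, f y ∂P) =
        ∫ y : ι → X, ∑ i, (f (x i) - f (y i)) ∂(Measure.pi fun _ : ι => P) := by
      rw [integral_finsetSum (f := fun i (y : ι → X) => f (x i) - f (y i)) _
        fun i _ => (integrable_const _).sub (hi i)]
      refine Finset.sum_congr rfl fun i _ => ?_
      rw [integral_sub (integrable_const _) (hi i), hev i]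
      simp
    rw [heq, ← Real.enorm_eq_ofReal_abs]
    refine (enorm_integral_le_lintegral_enorm _).trans (lintegral_mono fun y => ?_)
    refine le_trans ?_ (hH _)
    refine le_trans (le_of_eq ?_) (le_iSup₂ (f := fun (f : X → ℝ) (_ : f ∈ ℱ) =>
      ENNReal.ofReal |∑ i, (Sum.elim 1 (-1) : ι ⊕ ι → ℝ) i * f (E.symm (x, y) i)|) f hf)
    rw [Real.enorm_eq_ofReal_abs, Fintype.sum_sum_type]
    congr 2
    rw [Finset.sum_sub_distrib, sub_eq_add_neg, ← Finset.sum_neg_distrib]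
    simp [E, MeasurableEquiv.sumPiEquivProdPi, Equiv.sumPiEquivProdPi]
  · refine le_trans (le_of_eq ?_) (lintegral_signedSup_one_neg_one_le h he)
    rw [← lintegral_prod _ hHE.aemeasurable,
      lintegral_comp_measurePreserving hE hHm.aemeasurable, hHint]

end Symmetrization

/-! ### Exponential tails of the envelope. -/

section Tail

/-- A constant `C` with `y⁴ ≤ C exp(y^p / 2)` for all `y ≥ 0`. -/
noncomputable def quarticExpConst (p : ℝ) : ℝ := 2 ^ ⌈4 / p⌉₊ * (⌈4 / p⌉₊.factorial : ℝ)

theorem quarticExpConst_nonneg (p : ℝ) : 0 ≤ quarticExpConst p := by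
  unfold quarticExpConst; positivity

/-- For y ≥ 1, y⁴ ≤ (y^p)^N with N = ⌈4/p⌉, and z^N/N! ≤ exp z at z = y^p/2. -/
theorem pow_four_le_exp {p y : ℝ} (hp : 0 < p) (hy : 0 ≤ y) :
    y ^ 4 ≤ quarticExpConst p * Real.exp (y ^ p / 2) := by
  set N := ⌈4 / p⌉₊ with hN
  have hy0 : 0 ≤ y ^ p := Real.rpow_nonneg hy p
  rcases le_total y 1 with h1 | h1
  · have h2 : y ^ 4 ≤ 1 := pow_le_one₀ hy h1
    have h3 : (1 : ℝ) ≤ 2 ^ N * (N.factorial : ℝ) := by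
      have h5 : (1 : ℝ) ≤ 2 ^ N := one_le_pow₀ (by norm_num)
      have h6 : (1 : ℝ) ≤ N.factorial := by exact_mod_cast N.factorial_pos
      nlinarith
    have h4 : 1 ≤ Real.exp (y ^ p / 2) := Real.one_le_exp (by positivity)
    calc y ^ 4 ≤ 1 * 1 := by linarith
      _ ≤ _ := mul_le_mul h3 h4 zero_le_one (by positivity)
  · have h2 : y ^ 4 ≤ (y ^ p) ^ N := by
      rw [← Real.rpow_natCast (y ^ p), ← Real.rpow_mul hy, ← Real.rpow_natCast y 4]
      refine Real.rpow_le_rpow_of_exponent_le h1 ?_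
      have := Nat.le_ceil (4 / p)
      rw [div_le_iff₀ hp] at this
      push_cast
      linarith
    have h3 := Real.pow_div_factorial_le_exp (y ^ p / 2) (by positivity) N
    rw [div_pow, div_div, div_le_iff₀ (by positivity)] at h3
    calc y ^ 4 ≤ _ := h2
      _ ≤ _ := h3
      _ = _ := by rw [quarticExpConst]; ring

/-- Half of the exponent y^p absorbs y⁴; the other half, where y > K, supplies the decay
exp(-K^p/2). -/
theorem pow_four_tail_le {p q K y : ℝ} (hp : 0 < p) (hpq : p ≤ q) (hK : 1 ≤ K) (hy : K < y) :
    y ^ 4 ≤ quarticExpConst p * Real.exp (-(K ^ p) / 2) * Real.exp (y ^ q) := by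
  have hy0 : 0 ≤ y := by linarith
  refine (pow_four_le_exp hp hy0).trans ?_
  rw [mul_assoc, ← Real.exp_add]
  have h1 : K ^ p ≤ y ^ p := Real.rpow_le_rpow (by linarith) hy.le hp.le
  have h2 : y ^ p ≤ y ^ q := Real.rpow_le_rpow_of_exponent_le (by linarith) hpq
  have := quarticExpConst_nonneg p
  gcongr
  linarith

variable {X : Type*} [MeasurableSpace X] {P : Measure X} {F : X → ℝ}

theorem integrable_pow_four_of_exp (hF : Measurable F) (hF0 : ∀ x, 0 ≤ F x) {q : ℝ} (hq : 0 < q)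
    (hexp : Integrable (fun x => Real.exp (F x ^ q)) P) : Integrable (fun x => F x ^ 4) P := by
  refine (hexp.const_mul (quarticExpConst q)).mono' (hF.pow_const 4).aestronglyMeasurable
    (Filter.Eventually.of_forall fun x => ?_)
  rw [Real.norm_eq_abs, abs_of_nonneg (by positivity)]
  refine (pow_four_le_exp hq (hF0 x)).trans ?_
  have := quarticExpConst_nonneg q
  have : 0 ≤ F x ^ q := Real.rpow_nonneg (hF0 x) q
  gcongr
  linarith

theorem integral_pow_four_tail_le {p q K : ℝ} (hp : 0 < p) (hpq : p ≤ q)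
    (hK : 1 ≤ K) (hexp : Integrable (fun x => Real.exp (F x ^ q)) P) :
    ∫ x, {x | K < F x}.indicator (fun x => F x ^ 4) x ∂P ≤
      quarticExpConst p * Real.exp (-(K ^ p) / 2) * ∫ x, Real.exp (F x ^ q) ∂P := by
  rw [← integral_const_mul]
  have := quarticExpConst_nonneg p
  refine integral_mono_of_nonneg (Filter.Eventually.of_forall fun x => ?_) (hexp.const_mul _)
    (Filter.Eventually.of_forall fun x => ?_)
  · exact Set.indicator_nonneg (fun x _ => by positivity) x
  · by_cases hx : K < F x
    · simpa [hx] using pow_four_tail_le hp hpq hK hx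
    · simp only [Set.indicator, Set.mem_ofPred_eq, hx, if_false]
      positivity

end Tail

/-! ### Empirical second moments. -/

section SecondMoments

variable {X ι : Type*} [Fintype ι]

theorem signedSup_powClass (ℱ : Set (X → ℝ)) (k : ℕ) (e : ι → ℝ) (x : ι → X) :
    signedSup (powClass ℱ k) e x = ⨆ f ∈ ℱ, ENNReal.ofReal |∑ i, e i * f (x i) ^ k| := by
  have : powClass ℱ k = (fun (f : X → ℝ) x => f x ^ k) '' ℱ := by
    ext g
    simp [powClass, eq_comm]
  rw [this, signedSup, iSup_image]

/-- The supremum of the empirical second moments `∑ᵢ f(xᵢ)²`, `f ∈ ℱ`. -/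
noncomputable def sqSup (ℱ : Set (X → ℝ)) (x : ι → X) : ℝ :=
  (signedSup (powClass ℱ 2) 1 x).toReal

theorem sqSup_nonneg (ℱ : Set (X → ℝ)) (x : ι → X) : 0 ≤ sqSup ℱ x := ENNReal.toReal_nonneg

end SecondMoments

/-! ### Expected bounds for the second moments and for the empirical process. -/

section Moments

variable {X : Type*} [MeasurableSpace X] {P : Measure X} [IsProbabilityMeasure P]
  {ι : Type*} [Fintype ι]

theorem integrable_sum_comp_eval {h : X → ℝ} (hh : Integrable h P) :
    Integrable (fun x : ι → X => ∑ i, h (x i)) (Measure.pi fun _ : ι => P) :=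
  integrable_finsetSum _ fun i _ =>
    (measurePreserving_eval (fun _ : ι => P) i).integrable_comp_of_integrable hh

theorem integral_sum_comp_eval {h : X → ℝ} (hh : Integrable h P) :
    ∫ x : ι → X, ∑ i, h (x i) ∂(Measure.pi fun _ : ι => P) =
      Fintype.card ι * ∫ y, h y ∂P := by
  rw [integral_finsetSum (f := fun i (x : ι → X) => h (x i)) _ fun i _ =>
    (measurePreserving_eval (fun _ : ι => P) i).integrable_comp_of_integrable hh]
  have hev : ∀ i, ∫ x : ι → X, h (x i) ∂(Measure.pi fun _ : ι => P) = ∫ y, h y ∂P := fun i =>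
    integral_comp_eval (μ := fun _ : ι => P) hh.aestronglyMeasurable
  simp [hev]

theorem lintegral_ofReal_sqrt_le {α : Type*} [MeasurableSpace α] {μ : Measure α}
    [IsProbabilityMeasure μ] {g : α → ℝ} (hg : Integrable g μ) (hg0 : ∀ a, 0 ≤ g a) :
    ∫⁻ a, ENNReal.ofReal √(g a) ∂μ ≤ ENNReal.ofReal √(∫ a, g a ∂μ) := by
  have hint : Integrable (fun a => √(g a)) μ := by
    refine (hg.add (integrable_const 1)).mono'
      (Real.continuous_sqrt.comp_aestronglyMeasurable hg.aestronglyMeasurable)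
      (Filter.Eventually.of_forall fun a => ?_)
    rw [Real.norm_eq_abs, abs_of_nonneg (Real.sqrt_nonneg _)]
    have h1 := Real.sq_sqrt (hg0 a)
    change √(g a) ≤ g a + 1
    nlinarith [sq_nonneg (√(g a) - 1)]
  rw [← ofReal_integral_eq_lintegral_ofReal hint
    (Filter.Eventually.of_forall fun a => Real.sqrt_nonneg _)]
  refine ENNReal.ofReal_le_ofReal ?_
  exact Real.strictConcaveOn_sqrt.concaveOn.le_map_integral Real.continuous_sqrt.continuousOn
    isClosed_Ici (Filter.Eventually.of_forall hg0) hg hint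

/-- Symmetrization and averaging over all signs. -/
theorem exists_majorant_centered_le_average {ℱ : Set (X → ℝ)} (h : IsPMeasurable P ℱ)
    (hint : ∀ f ∈ ℱ, Integrable f P) [DecidableEq ι] {G : (ι → X) → ℝ≥0∞}
    (hG : ∀ x, ∑ e : ι → Bool, signedSup ℱ (fun i => boolSign (e i)) x ≤
      2 ^ Fintype.card ι * G x) :
    ∃ U : (ι → X) → ℝ≥0∞, Measurable U ∧
      (∀ x, ⨆ f ∈ ℱ, ENNReal.ofReal |∑ i, (f (x i) - ∫ y, f y ∂P)| ≤ U x) ∧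
      ∫⁻ x, U x ∂(Measure.pi fun _ : ι => P) ≤
        2 * ∫⁻ x, G x ∂(Measure.pi fun _ : ι => P) := by
  obtain ⟨U, hUm, hU, hUint⟩ := exists_majorant_centered (ι := ι) h hint
  refine ⟨U, hUm, hU, ?_⟩
  set A := ∫⁻ x, U x ∂(Measure.pi fun _ : ι => P)
  -- The bound holds for each fixed sign vector, so it may be summed over all of them and 2^|ι|
  -- cancelled.
  have hsum : (2 : ℝ≥0∞) ^ Fintype.card ι * A ≤
      2 ^ Fintype.card ι * (2 * ∫⁻ x, G x ∂(Measure.pi fun _ : ι => P)) := by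
    calc (2 : ℝ≥0∞) ^ Fintype.card ι * A = ∑ _e : ι → Bool, A := by simp
      _ ≤ ∑ e : ι → Bool, 2 * ∫⁻ x, signedSup ℱ (fun i => boolSign (e i)) x
            ∂(Measure.pi fun _ : ι => P) :=
          Finset.sum_le_sum fun e _ => hUint _ fun i => boolSign_eq _
      _ = 2 * ∫⁻ x, ∑ e : ι → Bool, signedSup ℱ (fun i => boolSign (e i)) x
            ∂(Measure.pi fun _ : ι => P) := by
          rw [lintegral_finsetSum' _ fun e _ => h.aemeasurable fun i => boolSign_eq _,
            Finset.mul_sum]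
      _ ≤ 2 * ∫⁻ x, 2 ^ Fintype.card ι * G x ∂(Measure.pi fun _ : ι => P) := by
          gcongr with x
          exact hG x
      _ = _ := by
          rw [lintegral_const_mul' _ _ (by simp)]
          ring
  exact (ENNReal.mul_le_mul_iff_right (by simp) (by simp)).1 hsum

variable {ℱ : Set (X → ℝ)} {F : X → ℝ}

theorem signedSup_sq_le (hF : IsEnvelope ℱ F) (x : ι → X) :
    signedSup (powClass ℱ 2) 1 x ≤ ENNReal.ofReal (∑ i, F (x i) ^ 2) := by
  rw [signedSup_powClass]
  refine iSup₂_le fun f hf => ENNReal.ofReal_le_ofReal ?_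
  rw [abs_of_nonneg (Finset.sum_nonneg fun i _ => by simp; positivity)]
  refine Finset.sum_le_sum fun i _ => ?_
  rw [Pi.one_apply, one_mul]
  exact sq_le_sq' (neg_le_of_abs_le (hF.abs_le f hf _)) (le_of_abs_le (hF.abs_le f hf _))

/-- The envelope makes the supremum finite, so `toReal` loses nothing. -/
theorem ofReal_sqSup (hF : IsEnvelope ℱ F) (x : ι → X) :
    ENNReal.ofReal (sqSup ℱ x) = signedSup (powClass ℱ 2) 1 x :=
  ENNReal.ofReal_toReal (ne_top_of_le_ne_top ENNReal.ofReal_ne_top (signedSup_sq_le hF x))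

theorem sum_sq_le_sqSup (hF : IsEnvelope ℱ F) (x : ι → X) {f : X → ℝ} (hf : f ∈ ℱ) :
    ∑ i, f (x i) ^ 2 ≤ sqSup ℱ x := by
  rw [← ENNReal.ofReal_le_ofReal_iff (sqSup_nonneg ℱ x), ofReal_sqSup hF, signedSup_powClass]
  refine le_trans (ENNReal.ofReal_le_ofReal ?_) (le_iSup₂ (f := fun (f : X → ℝ) (_ : f ∈ ℱ) =>
      ENNReal.ofReal |∑ i, (1 : ι → ℝ) i * f (x i) ^ 2|) f hf)
  simpa using le_abs_self (∑ i, f (x i) ^ 2)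

theorem integrable_sqSup (hF : IsEnvelope ℱ F) (hF2 : Integrable (fun x => F x ^ 2) P)
    (h2 : IsPMeasurable P (powClass ℱ 2)) :
    Integrable (sqSup ℱ) (Measure.pi fun _ : ι => P) := by
  refine (integrable_sum_comp_eval (ι := ι) hF2).mono'
    (h2.aemeasurable fun _ => Or.inl rfl).ennreal_toReal.aestronglyMeasurable
    (Filter.Eventually.of_forall fun x => ?_)
  rw [Real.norm_eq_abs, abs_of_nonneg (sqSup_nonneg ℱ x)]
  exact ENNReal.toReal_le_of_le_ofReal (Finset.sum_nonneg fun i _ => sq_nonneg _)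
    (signedSup_sq_le hF x)

/-- Where F ≤ K, f⁴ ≤ K² f²; elsewhere f⁴ ≤ F⁴. Fourth moments thus return to second moments, which
closes the recursion. -/
theorem sqrt_sum_pow_four_le (hF : IsEnvelope ℱ F) (x : ι → X) {K : ℝ} (hK : 0 ≤ K) {f : X → ℝ}
    (hf : f ∈ ℱ) :
    √(∑ i, f (x i) ^ 4) ≤ K * √(sqSup ℱ x) +
      √(∑ i, {x | K < F x}.indicator (fun x => F x ^ 4) (x i)) := by
  set R := ∑ i, {x | K < F x}.indicator (fun x => F x ^ 4) (x i) with hR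
  have hR0 : 0 ≤ R := Finset.sum_nonneg fun i _ => Set.indicator_nonneg
    (fun x _ => by positivity) _
  have h1 : ∑ i, f (x i) ^ 4 ≤ K ^ 2 * sqSup ℱ x + R := by
    calc ∑ i, f (x i) ^ 4 ≤ ∑ i, (K ^ 2 * f (x i) ^ 2 +
          {x | K < F x}.indicator (fun x => F x ^ 4) (x i)) := by
          refine Finset.sum_le_sum fun i _ => ?_
          have hle := hF.abs_le f hf (x i)
          by_cases hx : K < F (x i)
          · have := pow_le_pow_left₀ (abs_nonneg _) hle 4
            rw [Even.pow_abs (by decide)] at this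
            simp only [Set.indicator, Set.mem_ofPred_eq, hx, if_true]
            nlinarith [mul_nonneg (sq_nonneg K) (sq_nonneg (f (x i)))]
          · have h3 : f (x i) ^ 2 ≤ K ^ 2 := by
              rw [← sq_abs]
              exact pow_le_pow_left₀ (abs_nonneg _) (hle.trans (not_lt.1 hx)) 2
            simp only [Set.indicator, Set.mem_ofPred_eq, hx, if_false]
            nlinarith [sq_nonneg (f (x i))]
      _ = K ^ 2 * ∑ i, f (x i) ^ 2 + R := by rw [Finset.sum_add_distrib, Finset.mul_sum]
      _ ≤ _ := by gcongr; exact sum_sq_le_sqSup hF x hf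
  rw [Real.sqrt_le_left (by positivity), add_sq, mul_pow, Real.sq_sqrt (sqSup_nonneg ℱ x),
    Real.sq_sqrt hR0]
  have : 0 ≤ 2 * (K * √(sqSup ℱ x)) * √R := by positivity
  linarith

/-- The recursive inequality for the expected supremum of the empirical second moments. -/
theorem integral_sqSup_le [DecidableEq ι] (hℱ : ∀ f ∈ ℱ, Measurable f)
    (h2 : IsPMeasurable P (powClass ℱ 2)) (hF : IsEnvelope ℱ F)
    (hF2 : Integrable (fun x => F x ^ 2) P) (hF4 : Integrable (fun x => F x ^ 4) P)
    {s b K : ℝ} (hs : 0 ≤ s) (hb : 0 < b) (hK : 0 ≤ K) (hfs : ∀ f ∈ ℱ, ∫ x, f x ^ 2 ∂P ≤ s)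
    (hJ : uniformEntropyIntegral ℱ F b ≠ ⊤) :
    ∫ x, sqSup ℱ x ∂(Measure.pi fun _ : ι => P) ≤ Fintype.card ι * s +
      36 * (uniformEntropyIntegral ℱ F b).toReal *
        (2 * √(Fintype.card ι * ∫ x, F x ^ 4 ∂P) +
          (K * √(∫ x, sqSup ℱ x ∂(Measure.pi fun _ : ι => P)) +
            √(Fintype.card ι * ∫ x, {x | K < F x}.indicator (fun x => F x ^ 4) x ∂P)) / b) := by
  set μ := Measure.pi fun _ : ι => P
  set J := uniformEntropyIntegral ℱ F b
  set R : X → ℝ := {x | K < F x}.indicator (fun x => F x ^ 4) with hRdef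
  have hR : Integrable R P := hF4.indicator (measurableSet_lt measurable_const hF.measurable)
  have hR0 : ∀ x, 0 ≤ R x := fun x => Set.indicator_nonneg (fun x _ => by positivity) x
  have hV := integrable_sqSup (ι := ι) hF hF2 h2
  set G : (ι → X) → ℝ≥0∞ := fun x => 18 * ENNReal.ofReal (2 * √(∑ i, F (x i) ^ 4) +
    (K * √(sqSup ℱ x) + √(∑ i, R (x i))) / b) * J with hGdef
  have hfint : ∀ f ∈ ℱ, Integrable (fun x => f x ^ 2) P := fun f hf =>
    hF2.mono' ((hℱ f hf).pow_const 2).aestronglyMeasurable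
      (Filter.Eventually.of_forall fun x => by
        rw [Real.norm_eq_abs, abs_of_nonneg (sq_nonneg _)]
        exact sq_le_sq' (neg_le_of_abs_le (hF.abs_le f hf _)) (le_of_abs_le (hF.abs_le f hf _)))
  obtain ⟨U, hUm, hU, hUint⟩ := exists_majorant_centered_le_average (ι := ι) h2
    (by rintro _ ⟨f, hf, rfl⟩; exact hfint f hf) (G := G) (fun x => by
      simp only [signedSup_powClass]
      exact sum_iSup_sq_le_uniformEntropyIntegral hℱ hF x hb
        fun f hf => sqrt_sum_pow_four_le hF x hK hf)
  -- Centring the squares costs at most n s, as P f² ≤ s.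
  have hVU : ∀ x, ENNReal.ofReal (sqSup ℱ x) ≤ U x + ENNReal.ofReal (Fintype.card ι * s) := by
    intro x
    rw [ofReal_sqSup hF, signedSup_powClass]
    refine iSup₂_le fun f hf => ?_
    have h3 : |∑ i, (1 : ι → ℝ) i * f (x i) ^ 2| ≤
        |∑ i, (f (x i) ^ 2 - ∫ y, f y ^ 2 ∂P)| + Fintype.card ι * s := by
      have h4 : ∑ i, (1 : ι → ℝ) i * f (x i) ^ 2 =
          ∑ i, (f (x i) ^ 2 - ∫ y, f y ^ 2 ∂P) + Fintype.card ι * ∫ y, f y ^ 2 ∂P := by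
        simp [Finset.sum_sub_distrib]
      have h5 : 0 ≤ ∫ y, f y ^ 2 ∂P := integral_nonneg fun y => sq_nonneg _
      rw [h4]
      refine (abs_add_le _ _).trans ?_
      rw [abs_of_nonneg (a := Fintype.card ι * ∫ y, f y ^ 2 ∂P) (by positivity)]
      gcongr
      exact hfs f hf
    refine (ENNReal.ofReal_le_ofReal h3).trans ?_
    rw [ENNReal.ofReal_add (abs_nonneg _) (by positivity)]
    gcongr
    exact (le_iSup₂ (f := fun (g : X → ℝ) (_ : g ∈ powClass ℱ 2) =>
      ENNReal.ofReal |∑ i, (g (x i) - ∫ y, g y ∂P)|) (fun x => f x ^ 2) ⟨f, hf, rfl⟩).trans (hU x)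
  set Y : ℝ := 2 * √(Fintype.card ι * ∫ x, F x ^ 4 ∂P) +
      (K * √(∫ x, sqSup ℱ x ∂μ) + √(Fintype.card ι * ∫ x, R x ∂P)) / b with hY
  have hY0 : 0 ≤ Y := by rw [hY]; positivity
  -- Jensen moves the expectation under each root, so the unknown reappears as √EV.
  have hGint : ∫⁻ x, G x ∂μ ≤ 18 * ENNReal.ofReal Y * J := by
    have e1 : ∀ x, G x = 18 * J * (2 * ENNReal.ofReal √(∑ i, F (x i) ^ 4) +
        (ENNReal.ofReal (K / b) * ENNReal.ofReal √(sqSup ℱ x) +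
          ENNReal.ofReal (1 / b) * ENNReal.ofReal √(∑ i, R (x i)))) := by
      intro x
      rw [← ENNReal.ofReal_mul (by positivity), ← ENNReal.ofReal_mul (by positivity),
        ← ENNReal.ofReal_ofNat 2, ← ENNReal.ofReal_mul (by positivity),
        ← ENNReal.ofReal_add (by positivity) (by positivity),
        ← ENNReal.ofReal_add (by positivity) (by positivity), hGdef]
      simp only
      rw [mul_right_comm]
      congr 2
      field_simp
    have hm1 : AEMeasurable (fun x : ι → X => ENNReal.ofReal √(∑ i, F (x i) ^ 4)) μ :=
      (Real.continuous_sqrt.measurable.comp_aemeasurable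
        (integrable_sum_comp_eval hF4).aemeasurable).ennreal_ofReal
    have hm2 : AEMeasurable (fun x : ι → X => ENNReal.ofReal √(sqSup ℱ x)) μ :=
      (Real.continuous_sqrt.measurable.comp_aemeasurable hV.aemeasurable).ennreal_ofReal
    rw [lintegral_congr e1, lintegral_const_mul' _ _ (ENNReal.mul_ne_top (by simp) hJ),
      lintegral_add_left' (hm1.const_mul _), lintegral_add_left' (hm2.const_mul _),
      lintegral_const_mul' _ _ (by simp), lintegral_const_mul' _ _ (by simp),
      lintegral_const_mul' _ _ (by simp)]
    have i1 := lintegral_ofReal_sqrt_le (integrable_sum_comp_eval (ι := ι) hF4)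
      fun x => Finset.sum_nonneg fun i _ => by positivity
    have i2 := lintegral_ofReal_sqrt_le hV (sqSup_nonneg ℱ)
    change _ ≤ ENNReal.ofReal √(∫ a, sqSup ℱ a ∂μ) at i2
    have i3 := lintegral_ofReal_sqrt_le (integrable_sum_comp_eval (ι := ι) hR)
      fun x => Finset.sum_nonneg fun i _ => hR0 _
    rw [integral_sum_comp_eval hF4] at i1
    rw [integral_sum_comp_eval hR] at i3
    rw [hY]
    refine (mul_le_mul_right (add_le_add (mul_le_mul_right i1 _) (add_le_add
      (mul_le_mul_right i2 _) (mul_le_mul_right i3 _))) _).trans (le_of_eq ?_)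
    rw [← ENNReal.ofReal_mul (by positivity), ← ENNReal.ofReal_mul (by positivity),
        ← ENNReal.ofReal_ofNat 2, ← ENNReal.ofReal_mul (by positivity),
        ← ENNReal.ofReal_add (by positivity) (by positivity),
        ← ENNReal.ofReal_add (by positivity) (by positivity), mul_right_comm]
    congr 2
    field_simp
  have hfinal : ENNReal.ofReal (∫ x, sqSup ℱ x ∂μ) ≤ ENNReal.ofReal (Fintype.card ι * s +
      36 * J.toReal * Y) := by
    rw [ofReal_integral_eq_lintegral_ofReal hV (Filter.Eventually.of_forall (sqSup_nonneg ℱ))]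
    calc _ ≤ ∫⁻ x, (U x + ENNReal.ofReal (Fintype.card ι * s)) ∂μ := lintegral_mono hVU
      _ = ∫⁻ x, U x ∂μ + ENNReal.ofReal (Fintype.card ι * s) := by
        rw [lintegral_add_left hUm]; simp [μ]
      _ ≤ 2 * (18 * ENNReal.ofReal Y * J) +
          ENNReal.ofReal (Fintype.card ι * s) := by
        gcongr
        exact hUint.trans (by gcongr)
      _ = _ := by
        rw [ENNReal.ofReal_add (p := Fintype.card ι * s) (by positivity) (by positivity),
          ENNReal.ofReal_mul (p := 36 * J.toReal) (by positivity),
          ENNReal.ofReal_mul (p := 36) (by positivity), ENNReal.ofReal_toReal hJ,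
          ENNReal.ofReal_ofNat, add_comm]
        congr 1
        ring
  refine (ENNReal.ofReal_le_ofReal_iff ?_).1 hfinal
  positivity

/-- The bound for the empirical process by the expected supremum of the second moments. -/
theorem outerExpectation_empiricalSup_le {n : ℕ} (hn : 1 ≤ n) (hℱ : ∀ f ∈ ℱ, Measurable f)
    (h1 : IsPMeasurable P ℱ) (h2 : IsPMeasurable P (powClass ℱ 2)) (hF : IsEnvelope ℱ F)
    (hF1 : Integrable F P) (hF2 : Integrable (fun x => F x ^ 2) P) {b : ℝ} (hb : 0 < b) :
    outerExpectation (Measure.pi fun _ : Fin n => P) (fun x => empiricalSup P ℱ x) ≤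
      36 * uniformEntropyIntegral ℱ F b * ENNReal.ofReal (√(∫ x, F x ^ 2 ∂P) +
        √((∫ x, sqSup ℱ x ∂(Measure.pi fun _ : Fin n => P)) / n) / b) := by
  set μ := Measure.pi fun _ : Fin n => P
  set J := uniformEntropyIntegral ℱ F b
  have hn0 : (0 : ℝ) < n := by exact_mod_cast hn
  have hV := integrable_sqSup (ι := Fin n) hF hF2 h2
  obtain ⟨U, hUm, hU, hUint⟩ := exists_majorant_centered_le_average (ι := Fin n) h1
    (fun f hf => hF1.mono' (hℱ f hf).aestronglyMeasurable
      (Filter.Eventually.of_forall (hF.abs_le f hf)))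
    (G := fun x => 18 * ENNReal.ofReal (√(∑ i, F (x i) ^ 2) + √(sqSup ℱ x) / b) * J)
    (fun x => sum_iSup_le_uniformEntropyIntegral hℱ hF x hb
        fun f hf => Real.sqrt_le_sqrt (sum_sq_le_sqSup hF x hf))
  have hbound : outerExpectation μ (fun x => empiricalSup P ℱ x) ≤
      ∫⁻ x, ENNReal.ofReal (1 / √(n : ℝ)) * U x ∂μ := by
    refine iInf_le_of_le _ (iInf_le_of_le (hUm.const_mul _) (iInf_le _ fun x => ?_))
    refine iSup₂_le fun f hf => ?_
    rw [empProc, abs_mul, abs_of_nonneg (by positivity), ENNReal.ofReal_mul (by positivity)]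
    gcongr
    exact (le_iSup₂ (f := fun (g : X → ℝ) (_ : g ∈ ℱ) =>
      ENNReal.ofReal |∑ i, (g (x i) - ∫ y, g y ∂P)|) f hf).trans (hU x)
  refine hbound.trans ?_
  rw [lintegral_const_mul _ hUm]
  have hGint : ∫⁻ x : Fin n → X, 18 * ENNReal.ofReal (√(∑ i, F (x i) ^ 2) + √(sqSup ℱ x) / b) * J
      ∂μ ≤ 18 * J * ENNReal.ofReal (√(n * ∫ x, F x ^ 2 ∂P) + √(∫ x, sqSup ℱ x ∂μ) / b) := by
    have e1 : ∀ x : Fin n → X, 18 * ENNReal.ofReal (√(∑ i, F (x i) ^ 2) + √(sqSup ℱ x) / b) * J =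
        (ENNReal.ofReal √(∑ i, F (x i) ^ 2) +
          ENNReal.ofReal (1 / b) * ENNReal.ofReal √(sqSup ℱ x)) * (18 * J) := by
      intro x
      rw [← ENNReal.ofReal_mul (by positivity), ← ENNReal.ofReal_add (by positivity) (by positivity),
        one_div_mul_eq_div]
      ring
    have hm1 : AEMeasurable (fun x : Fin n → X => ENNReal.ofReal √(∑ i, F (x i) ^ 2)) μ :=
      (Real.continuous_sqrt.measurable.comp_aemeasurable
        (integrable_sum_comp_eval hF2).aemeasurable).ennreal_ofReal
    have hm2 : AEMeasurable (fun x : Fin n → X => ENNReal.ofReal √(sqSup ℱ x)) μ :=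
      (Real.continuous_sqrt.measurable.comp_aemeasurable hV.aemeasurable).ennreal_ofReal
    have hm3 : AEMeasurable (fun x : Fin n → X => ENNReal.ofReal √(∑ i, F (x i) ^ 2) +
        ENNReal.ofReal (1 / b) * ENNReal.ofReal √(sqSup ℱ x)) μ := hm1.add (hm2.const_mul _)
    rw [lintegral_congr e1, lintegral_mul_const'' _ hm3,
      lintegral_add_left' hm1, lintegral_const_mul' _ _ (by simp), mul_comm (18 * J)]
    have i1 := lintegral_ofReal_sqrt_le (integrable_sum_comp_eval (ι := Fin n) hF2)
      fun x => Finset.sum_nonneg fun i _ => by positivity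
    have i2 := lintegral_ofReal_sqrt_le hV (sqSup_nonneg ℱ)
    change _ ≤ ENNReal.ofReal √(∫ a, sqSup ℱ a ∂μ) at i2
    rw [integral_sum_comp_eval hF2, Fintype.card_fin] at i1
    refine (mul_le_mul_left (add_le_add i1 (mul_le_mul_right i2 _)) _).trans (le_of_eq ?_)
    rw [← ENNReal.ofReal_mul (by positivity), ← ENNReal.ofReal_add (by positivity) (by positivity),
      one_div_mul_eq_div]
  calc _ ≤ ENNReal.ofReal (1 / √(n : ℝ)) * (2 * (18 * J *
        ENNReal.ofReal (√(n * ∫ x, F x ^ 2 ∂P) + √(∫ x, sqSup ℱ x ∂μ) / b))) := by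
        gcongr
        exact hUint.trans (by gcongr)
    _ = 2 * 18 * J * (ENNReal.ofReal (1 / √(n : ℝ)) *
        ENNReal.ofReal (√(n * ∫ x, F x ^ 2 ∂P) + √(∫ x, sqSup ℱ x ∂μ) / b)) := by ring
    _ = _ := by
        rw [← ENNReal.ofReal_mul (by positivity)]
        congr 2
        · norm_num
        · rw [Real.sqrt_mul hn0.le, Real.sqrt_div' _ hn0.le]
          have : √(n : ℝ) ≠ 0 := (Real.sqrt_pos.2 hn0).ne'
          field_simp

end Moments

/-! ### The quadratic inequality and the final bound. -/

theorem ofReal_le_uniformEntropyIntegral {X : Type*} [MeasurableSpace X] [Nonempty X]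
    (ℱ : Set (X → ℝ)) (F : X → ℝ) (δ : ℝ) :
    ENNReal.ofReal δ ≤ uniformEntropyIntegral ℱ F δ := by
  obtain ⟨a⟩ := ‹Nonempty X›
  have hQ := isFinitelyDiscrete_weightedDirac (ι := Unit) (u := fun _ => 1)
    (fun _ => zero_le_one) (by simp) (fun _ => a)
  refine le_trans ?_ (le_iSup₂ (f := fun (Q : Measure X) (_ : IsFinitelyDiscrete Q) =>
    ∫⁻ ε in Set.Ioo 0 δ,
      sqrtOneAddLog (coveringNumberL2 Q ℱ (ENNReal.ofReal ε * eLpNorm F 2 Q).toNNReal)) _ hQ)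
  calc ENNReal.ofReal δ = ∫⁻ _ in Set.Ioo 0 δ, (1 : ℝ≥0∞) := by simp
    _ ≤ _ := lintegral_mono fun ε => one_le_sqrtOneAddLog _

/-- The bound for a nonnegative solution of a quadratic inequality `w² ≤ α + β B + γ B w`. -/
theorem le_of_sq_le_add_mul {w α β γ B : ℝ} (hα : 0 ≤ α) (hβ : 0 ≤ β)
    (hγ : 0 ≤ γ) (hB : 0 ≤ B) (h : w ^ 2 ≤ α + β * B + γ * B * w) :
    w ≤ (1 + α + β + γ) * (1 + B) := by
  -- Otherwise w > 1, so α + βB ≤ (α + βB)w and the hypothesis gives w ≤ α + βB + γB, a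
  -- contradiction.
  by_contra! hlt
  have hM : 1 + B ≤ (1 + α + β + γ) * (1 + B) := le_mul_of_one_le_left (by linarith) (by linarith)
  have h1 : 1 < w := by linarith
  have h2 : (1 + α + β + γ) * (1 + B) * w < w ^ 2 := by
    rw [sq]; exact mul_lt_mul_of_pos_right hlt (by linarith)
  have h3 : 0 ≤ α * (w - 1) := mul_nonneg hα (by linarith)
  have h4 : 0 ≤ β * B * (w - 1) := mul_nonneg (by positivity) (by linarith)
  have h5 : 0 ≤ w + B * w + α * B * w + β * w + γ * w := by
    have hw : 0 ≤ w := by linarith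
    positivity
  nlinarith

/-- The constant multiplying `B = J(δ L) / (δ² √n)` in the quadratic inequality for the second
moments. -/
noncomputable def linearConst (p m₄ A : ℝ) : ℝ :=
  72 * √m₄ + 36 * √(quarticExpConst p * A) / Real.log 2 ^ (1 / p)

theorem linearConst_nonneg (p m₄ A : ℝ) : 0 ≤ linearConst p m₄ A := by
  have : 0 ≤ Real.log 2 := Real.log_nonneg (by norm_num)
  unfold linearConst
  positivity

variable {X : Type*} [MeasurableSpace X] {P : Measure X} [IsProbabilityMeasure P]
  {ℱ : Set (X → ℝ)} {F : X → ℝ}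

theorem sqrt_integral_sqSup_le {n : ℕ} (hn : 1 ≤ n) (hℱ : ∀ f ∈ ℱ, Measurable f)
    (h2 : IsPMeasurable P (powClass ℱ 2)) (hF : IsEnvelope ℱ F)
    {p ρ δ : ℝ} (hp : 0 < p) (hρ : 0 < ρ)
    (hexp : Integrable (fun x => Real.exp (F x ^ (p + ρ))) P)
    (hF2 : Integrable (fun x => F x ^ 2) P) (hF4 : Integrable (fun x => F x ^ 4) P)
    (hδ : 0 < δ) (hδ2 : δ < 1 / 2)
    (hf : ∀ f ∈ ℱ, ∫ x, f x ^ 2 ∂P < δ ^ 2 * ∫ x, F x ^ 2 ∂P)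
    (hJ : uniformEntropyIntegral ℱ F (δ * Real.log (1 / δ) ^ (1 / p)) ≠ ⊤) :
    √((∫ x, sqSup ℱ x ∂(Measure.pi fun _ : Fin n => P)) / n) / δ ≤
      (1 + ∫ x, F x ^ 2 ∂P +
        linearConst p (∫ x, F x ^ 4 ∂P) (∫ x, Real.exp (F x ^ (p + ρ)) ∂P) +
        36 * 4 ^ (1 / p)) *
      (1 + (uniformEntropyIntegral ℱ F (δ * Real.log (1 / δ) ^ (1 / p))).toReal /
        (δ ^ 2 * √(n : ℝ))) := by
  set m₂ := ∫ x, F x ^ 2 ∂P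
  set m₄ := ∫ x, F x ^ 4 ∂P
  set A := ∫ x, Real.exp (F x ^ (p + ρ)) ∂P
  set l := Real.log (1 / δ) with hl
  set L := l ^ (1 / p) with hL
  set j := (uniformEntropyIntegral ℱ F (δ * L)).toReal with hj
  have hn0 : (0 : ℝ) < n := by exact_mod_cast hn
  have hm2 : 0 ≤ m₂ := integral_nonneg fun x => sq_nonneg _
  have hA : 0 ≤ A := integral_nonneg fun x => (Real.exp_pos _).le
  have hlog2 : 0 < Real.log 2 := Real.log_pos (by norm_num)
  have hl2 : Real.log 2 ≤ l := by
    refine Real.log_le_log (by norm_num) ?_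
    rw [le_div_iff₀ hδ]; linarith
  have hl0 : 0 < l := hlog2.trans_le hl2
  have hL0 : 0 < L := Real.rpow_pos_of_pos hl0 _
  have hL2 : Real.log 2 ^ (1 / p) ≤ L := Real.rpow_le_rpow hlog2.le hl2 (by positivity)
  -- The factor 4 gives exp(-K^p/2) = δ², so the root of the tail gains a factor δ. Since K is
  -- proportional to L, K/(δL) is a constant over δ.
  set K : ℝ := 4 ^ (1 / p) * L with hK
  have hKeq : K = (4 * l) ^ (1 / p) := by rw [hK, hL, Real.mul_rpow (by norm_num) hl0.le]
  have hK1 : 1 ≤ K := by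
    rw [hKeq]
    refine Real.one_le_rpow ?_ (by positivity)
    linarith [Real.log_two_gt_d9]
  have hKp : K ^ p = 4 * l := by
    rw [hKeq, ← Real.rpow_mul (by positivity), one_div_mul_cancel hp.ne', Real.rpow_one]
  have hexpK : Real.exp (-(K ^ p) / 2) = δ ^ 2 := by
    rw [hKp, hl, one_div, Real.log_inv,
      show -(4 * -Real.log δ) / 2 = Real.log δ + Real.log δ by ring, Real.exp_add,
      Real.exp_log hδ, sq]
  have htail := integral_pow_four_tail_le (P := P) (F := F) hp (by linarith : p ≤ p + ρ) hK1 hexp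
  rw [hexpK] at htail
  set r := ∫ x, {x | K < F x}.indicator (fun x => F x ^ 4) x ∂P
  have hr : √r ≤ δ * √(quarticExpConst p * A) := by
    have hC := quarticExpConst_nonneg p
    refine (Real.sqrt_le_sqrt htail).trans (le_of_eq ?_)
    rw [mul_right_comm, mul_comm, Real.sqrt_mul (sq_nonneg _), Real.sqrt_sq hδ.le]
  have hmain := integral_sqSup_le (ι := Fin n) hℱ h2 hF hF2 hF4 (s := δ ^ 2 * m₂)
    (by positivity) (mul_pos hδ hL0) (by positivity : 0 ≤ K) (fun f hfF => (hf f hfF).le) hJ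
  rw [Fintype.card_fin, ← hj] at hmain
  set V := ∫ x, sqSup ℱ x ∂(Measure.pi fun _ : Fin n => P)
  have hV0 : 0 ≤ V := integral_nonneg fun x => sqSup_nonneg ℱ x
  set w := √(V / n) / δ with hw
  have hw0 : 0 ≤ w := by positivity
  have hj0 : 0 ≤ j := ENNReal.toReal_nonneg
  set q := √(n : ℝ) with hq
  have hq0 : 0 < q := Real.sqrt_pos.2 hn0
  have hqq : q ^ 2 = n := Real.sq_sqrt hn0.le
  have hsV : √V = q * δ * w := by
    rw [hw, Real.sqrt_div' _ hn0.le, ← hq]; field_simp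
  have hVw : V = n * δ ^ 2 * w ^ 2 := by
    rw [← Real.sq_sqrt hV0, hsV, ← hqq]; ring
  refine le_of_sq_le_add_mul hm2 (linearConst_nonneg _ _ _) (by positivity) (by positivity) ?_
  rw [Real.sqrt_mul hn0.le, Real.sqrt_mul hn0.le, hsV, hVw] at hmain
  have hlast : √r / (δ * L) ≤ √(quarticExpConst p * A) / Real.log 2 ^ (1 / p) := by
    calc √r / (δ * L) ≤ δ * √(quarticExpConst p * A) / (δ * L) := by gcongr
      _ = √(quarticExpConst p * A) / L := by field_simp
      _ ≤ _ := by gcongr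
  have hrew : (K * (q * δ * w) + q * √r) / (δ * L) = q * (4 ^ (1 / p) * w + √r / (δ * L)) := by
    rw [hK]; field_simp
  rw [hrew] at hmain
  have hstep : n * δ ^ 2 * w ^ 2 ≤ n * δ ^ 2 * (m₂ +
      linearConst p m₄ A * (j / (δ ^ 2 * q)) + 36 * 4 ^ (1 / p) * (j / (δ ^ 2 * q)) * w) := by
    calc n * δ ^ 2 * w ^ 2 ≤ _ := hmain
      _ ≤ n * (δ ^ 2 * m₂) + 36 * j * (2 * (q * √m₄) + q * (4 ^ (1 / p) * w +
          √(quarticExpConst p * A) / Real.log 2 ^ (1 / p))) := by gcongr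
      _ = _ := by
          rw [linearConst, ← hqq]
          field_simp
          ring
  exact le_of_mul_le_mul_left hstep (by positivity)

/-- The constant of the maximal inequality. -/
noncomputable def maximalConst (p m₂ m₄ A : ℝ) : ℝ≥0 :=
  (36 * (√m₂ + (1 + m₂ + linearConst p m₄ A + 36 * 4 ^ (1 / p)))).toNNReal

theorem outerExpectation_empiricalSup_le_maximalConst {p ρ δ : ℝ} {n : ℕ}
    (hℱ : ∀ f ∈ ℱ, Measurable f) (h1 : IsPMeasurable P ℱ) (h2 : IsPMeasurable P (powClass ℱ 2))
    (hF : IsEnvelope ℱ F) (hp : 0 < p) (hρ : 0 < ρ)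
    (hexp : Integrable (fun x => Real.exp (F x ^ (p + ρ))) P) (hδ : 0 < δ) (hδ2 : δ < 1 / 2)
    (hf : ∀ f ∈ ℱ, ∫ x, f x ^ 2 ∂P < δ ^ 2 * ∫ x, F x ^ 2 ∂P) (hn : 1 ≤ n) :
    outerExpectation (Measure.pi fun _ : Fin n => P) (fun x => empiricalSup P ℱ x) ≤
      (maximalConst p (∫ x, F x ^ 2 ∂P) (∫ x, F x ^ 4 ∂P)
        (∫ x, Real.exp (F x ^ (p + ρ)) ∂P) : ℝ≥0∞) * uniformEntropyIntegral ℱ F δ *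
      (1 + uniformEntropyIntegral ℱ F (δ * Real.log (1 / δ) ^ (1 / p)) /
        ENNReal.ofReal (δ ^ 2 * √(n : ℝ))) := by
  have hn0 : (0 : ℝ) < n := by exact_mod_cast hn
  -- Nonnegativity of F comes from a member of the class, so the empty class is separate.
  rcases ℱ.eq_empty_or_nonempty with rfl | ⟨f₀, hf₀⟩
  · refine le_trans (iInf_le_of_le (fun _ => 0) (iInf_le_of_le measurable_const
      (iInf_le _ fun x => by simp [empiricalSup]))) ?_
    simp
  have hF0 : ∀ x, 0 ≤ F x := fun x => (abs_nonneg _).trans (hF.abs_le f₀ hf₀ x)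
  have hF4 := integrable_pow_four_of_exp hF.measurable hF0 (by linarith : 0 < p + ρ) hexp
  have hF2 : Integrable (fun x => F x ^ 2) P := by
    refine (hF4.add (integrable_const 1)).mono' (hF.measurable.pow_const 2).aestronglyMeasurable
      (Filter.Eventually.of_forall fun x => ?_)
    rw [Real.norm_eq_abs, abs_of_nonneg (sq_nonneg _)]
    change F x ^ 2 ≤ F x ^ 4 + 1
    nlinarith [sq_nonneg (F x ^ 2 - 1)]
  have hF1 : Integrable F P := by
    refine (hF2.add (integrable_const 1)).mono' hF.measurable.aestronglyMeasurable
      (Filter.Eventually.of_forall fun x => ?_)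
    rw [Real.norm_eq_abs, abs_of_nonneg (hF0 x)]
    change F x ≤ F x ^ 2 + 1
    nlinarith [sq_nonneg (F x - 1), hF0 x]
  set m₂ := ∫ x, F x ^ 2 ∂P
  set m₄ := ∫ x, F x ^ 4 ∂P
  set A := ∫ x, Real.exp (F x ^ (p + ρ)) ∂P
  set J := uniformEntropyIntegral ℱ F (δ * Real.log (1 / δ) ^ (1 / p))
  have hm2 : 0 ≤ m₂ := integral_nonneg fun x => sq_nonneg _
  have hlc := linearConst_nonneg p m₄ A
  have hc : (maximalConst p m₂ m₄ A : ℝ≥0∞) =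
      ENNReal.ofReal (36 * (√m₂ + (1 + m₂ + linearConst p m₄ A + 36 * 4 ^ (1 / p)))) := rfl
  -- If J is infinite, so is the right side, provided the other factors are nonzero: the constant is
  -- positive and the entropy integral at δ is at least δ.
  by_cases hJ : J = ⊤
  · have : Nonempty X := nonempty_of_isProbabilityMeasure P
    have hJδ : uniformEntropyIntegral ℱ F δ ≠ 0 :=
      ((ENNReal.ofReal_pos.2 hδ).trans_le (ofReal_le_uniformEntropyIntegral ℱ F δ)).ne'
    have hc0 : (maximalConst p m₂ m₄ A : ℝ≥0∞) ≠ 0 := by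
      rw [hc]
      exact (ENNReal.ofReal_pos.2 (by positivity)).ne'
    rw [hJ, ENNReal.top_div_of_ne_top ENNReal.ofReal_ne_top, add_top,
      ENNReal.mul_top (mul_ne_zero hc0 hJδ)]
    exact le_top
  · refine (outerExpectation_empiricalSup_le hn hℱ h1 h2 hF hF1 hF2 hδ).trans ?_
    have hw := sqrt_integral_sqSup_le hn hℱ h2 hF hp hρ hexp hF2 hF4 hδ hδ2 hf hJ
    set w := √((∫ x, sqSup ℱ x ∂(Measure.pi fun _ : Fin n => P)) / n) / δ
    have hd : 0 < δ ^ 2 * √(n : ℝ) := by positivity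
    have hB : (1 : ℝ≥0∞) + J / ENNReal.ofReal (δ ^ 2 * √(n : ℝ)) =
        ENNReal.ofReal (1 + J.toReal / (δ ^ 2 * √(n : ℝ))) := by
      rw [ENNReal.ofReal_add zero_le_one (by positivity), ENNReal.ofReal_one,
        ENNReal.ofReal_div_of_pos hd, ENNReal.ofReal_toReal hJ]
    rw [hB, hc, mul_right_comm, mul_right_comm _ (uniformEntropyIntegral ℱ F δ),
      ← ENNReal.ofReal_mul (by positivity), ← ENNReal.ofReal_ofNat 36,
      ← ENNReal.ofReal_mul (by positivity)]
    refine mul_le_mul_left (ENNReal.ofReal_le_ofReal ?_) _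
    rw [mul_assoc]
    refine mul_le_mul_of_nonneg_left ?_ (by norm_num)
    have hB0 : 0 ≤ J.toReal / (δ ^ 2 * √(n : ℝ)) := by positivity
    rw [add_mul]
    refine add_le_add ?_ hw
    exact le_mul_of_one_le_right (Real.sqrt_nonneg _) (by linarith)

end EmpiricalEntropy

theorem theorem3 :
    ∃ c : ℝ → ℝ → ℝ → ℝ → ℝ≥0,
      ∀ (X : Type*) [MeasurableSpace X] (P : Measure X) [IsProbabilityMeasure P]
        (ℱ : Set (X → ℝ)) (F : X → ℝ) (p ρ δ : ℝ) (n : ℕ),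
        (∀ f ∈ ℱ, Measurable f) →
        EmpiricalEntropy.IsPMeasurable P ℱ →
        EmpiricalEntropy.IsPMeasurable P (EmpiricalEntropy.powClass ℱ 2) →
        EmpiricalEntropy.IsPMeasurable P (EmpiricalEntropy.powClass ℱ 4) →
        EmpiricalEntropy.IsEnvelope ℱ F →
        0 < p → 0 < ρ →
        Integrable (fun x => Real.exp (F x ^ (p + ρ))) P →
        0 < δ → δ < 1 / 2 →
        (∀ f ∈ ℱ, ∫ x, f x ^ 2 ∂P < δ ^ 2 * ∫ x, F x ^ 2 ∂P) →
        1 ≤ n →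
        EmpiricalEntropy.outerExpectation (Measure.pi fun _ : Fin n => P)
            (fun x => EmpiricalEntropy.empiricalSup P ℱ x) ≤
          (c p (∫ x, F x ^ 2 ∂P) (∫ x, F x ^ 4 ∂P) (∫ x, Real.exp (F x ^ (p + ρ)) ∂P) : ℝ≥0∞) *
            EmpiricalEntropy.uniformEntropyIntegral ℱ F δ *
            (1 + EmpiricalEntropy.uniformEntropyIntegral ℱ F (δ * Real.log (1 / δ) ^ (1 / p)) /
              ENNReal.ofReal (δ ^ 2 * √(n : ℝ))) := by
  exact ⟨EmpiricalEntropy.maximalConst,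
    fun X _ P _ ℱ F p ρ δ n hℱ h1 h2 _ hF hp hρ hexp hδ hδ2 hf hn =>
      EmpiricalEntropy.outerExpectation_empiricalSup_le_maximalConst hℱ h1 h2 hF hp hρ hexp hδ hδ2
        hf hn⟩
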